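/- **Setting.** $\mathbf{IQC}$ is intuitionistic first-order predicate calculus with equality over an arbitrary first-order language, with primitives $\bot,\wedge,\vee,\supset,\exists,\forall$, presented by natural deduction (the usual introduction and elimination rules, ex falso, $t=t$, and the substitution rule $s=t,\ A(s)\,/\,A(t)$). $\mathbf{EQC}$ is its epistemic counterpart, classical first-order $\mathbf{S4}$ with equality: the formulas may also contain $\Box$; ex falso is replaced by reductio ad absurdum (from a derivation of $\bot$ from $\neg A$ infer $A$), the other rules are kept for all modal formulas, and there are the rules $\Box A/A$ and $A/\Box A$, the latter provided that all open assumptions are of the form $\Box B$. Heyting arithmetic $\mathbf{HA}$ (resp. epistemic arithmetic $\mathbf{EA}$) is $\mathbf{IQC}$ (resp. $\mathbf{EQC}$) in the language $0,s,+,\cdot$ together with the usual axioms for $0$ and $s$, the defining equations of $+$ and $\cdot$, and induction for all formulas of its language. Formulas may have free variables. The modified Rasiowa–Sikorski translation $A\mapsto A^{\Box_{RS}}$, from formulas without $\Box$ to formulas with $\Box$, is defined by: $A^{\Box_{RS}}=A$ if $A$ is $\bot$ or $s=t$; $A^{\Box_{RS}}=\Box A$ for every other atomic formula $A$; and $$(A\vee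 B)^{\Box_{RS}}=\Box A^{\Box_{RS}}\vee\Box B^{\Box_{RS}},\quad (A\wedge B)^{\Box_{RS}}=A^{\Box_{RS}}\wedge B^{\Box_{RS}},\quad (A\supset B)^{\Box_{RS}}=\Box(\Box A^{\Box_{RS}}\supset\Box B^{\Box_{RS}}),$$ $$(\exists x A)^{\Box_{RS}}=\exists x\,\Box A^{\Box_{RS}},\qquad (\forall x A)^{\Box_{RS}}=\forall x\,A^{\Box_{RS}}.$$ For a finite set $\Gamma$ of formulas of $\mathbf{IQC}$ and $E\in\Gamma$, write $\neg_E A$ for $A\supset E$. The Flagg–Friedman translation $B\mapsto B_\Gamma^{(E)}$, from $\mathbf{EQC}$ to $\mathbf{IQC}$, is defined by: $A_\Gamma^{(E)}=\neg_E\neg_E A$ for $A$ atomic (including $\bot$ and $s=t$); it commutes with $\wedge$, $\supset$ and $\forall$; and $$(A\vee B)_\Gamma^{(E)}=\neg_E\neg_E(A_\Gamma^{(E)}\vee B_\Gamma^{(E)}),\quad (\exists xA)_\Gamma^{(E)}=\neg_E\neg_E\exists x A_\Gamma^{(E)},\quad (\Box A)_\Gamma^{(E)}=\neg_E\neg_E\bigwedge_{C\in\Gamma}A_\Gamma^{(C)}.$$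 These clauses are read literally, without renaming of bound variables. **Theorem.** 1. For every formula $A$ of $\mathbf{IQC}$: $\ \mathbf{IQC}\vdash A$ if and only if $\mathbf{EQC}\vdash A^{\Box_{RS}}$. 2. For every formula $A$ of $\mathbf{HA}$: $\ \mathbf{HA}\vdash A$ if and only if $\mathbf{EA}\vdash A^{\Box_{RS}}$. 3. For every formula $A$ of $\mathbf{IQC}$, if $\Gamma$ is the set of all subformulas of $A$, then $A$ and $\bigwedge_{C\in\Gamma}(A^{\Box_{RS}})_\Gamma^{(C)}$ are interderivable in $\mathbf{IQC}$. -/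

import Mathlib

universe u v


/-- The term `t[s/x]`, where the variables are the natural numbers. -/
def termSubst {L : FirstOrder.Language.{u, v}} (x : ℕ) (s t : L.Term ℕ) : L.Term ℕ :=
  t.subst (fun y => if y = x then s else FirstOrder.Language.Term.var y)

/-! ### Intuitionistic first-order calculus with equality -/

namespace IQC

/-- Formulas of the first-order language `L` with equality, with named variables `0, 1, 2, …`;
all connectives and both quantifiers are primitive. -/
inductive Formula (L : FirstOrder.Language.{u, v}) : Type (max u v)
  | falsum : Formula L
  | eq (s t : L.Term ℕ) : Formula L
  | rel {n : ℕ} (R : L.Relations n) (ts : Fin n → L.Term ℕ) : Formula L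
  | and (A B : Formula L) : Formula L
  | or (A B : Formula L) : Formula L
  | imp (A B : Formula L) : Formula L
  | ex (x : ℕ) (A : Formula L) : Formula L
  | all (x : ℕ) (A : Formula L) : Formula L

namespace Formula

variable {L : FirstOrder.Language.{u, v}}

/-- The free variables of a formula. -/
def fv : Formula L → Finset ℕ
  | falsum => ∅
  | eq s t => s.varFinset ∪ t.varFinset
  | rel _ ts => Finset.univ.biUnion (fun i => (ts i).varFinset)
  | and A B => A.fv ∪ B.fv
  | or A B => A.fv ∪ B.fv
  | imp A B => A.fv ∪ B.fv
  | ex x A => A.fv.erase x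
  | all x A => A.fv.erase x

/-- `A.subst x t` is `A[t/x]`: every free occurrence of `x` in `A` is replaced by `t`
(no renaming of bound variables; the rules below require `t` to be free for `x` in `A`). -/
def subst (x : ℕ) (t : L.Term ℕ) : Formula L → Formula L
  | falsum => falsum
  | eq r s => eq (termSubst x t r) (termSubst x t s)
  | rel R ts => rel R (fun i => termSubst x t (ts i))
  | and A B => and (A.subst x t) (B.subst x t)
  | or A B => or (A.subst x t) (B.subst x t)
  | imp A B => imp (A.subst x t) (B.subst x t)
  | ex y A => if y = x then ex y A else ex y (A.subst x t)
  | all y A => if y = x then all y A else all y (A.subst x t)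

/-- The term `t` is free for the variable `x` in a formula: no free occurrence of `x` lies in the
scope of a quantifier that binds a variable of `t`. -/
def FreeFor (x : ℕ) (t : L.Term ℕ) : Formula L → Prop
  | falsum => True
  | eq _ _ => True
  | rel _ _ => True
  | and A B => A.FreeFor x t ∧ B.FreeFor x t
  | or A B => A.FreeFor x t ∧ B.FreeFor x t
  | imp A B => A.FreeFor x t ∧ B.FreeFor x t
  | ex y A => x ∉ (ex y A).fv ∨ (y ∉ t.varFinset ∧ A.FreeFor x t)
  | all y A => x ∉ (all y A).fv ∨ (y ∉ t.varFinset ∧ A.FreeFor x t)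

/-- Negation. -/
def neg (A : Formula L) : Formula L := imp A falsum

/-- The set of all subformulas of a formula (the formula itself included). -/
def subformulas : Formula L → Set (Formula L)
  | falsum => {falsum}
  | eq s t => {eq s t}
  | rel R ts => {rel R ts}
  | and A B => insert (and A B) (A.subformulas ∪ B.subformulas)
  | or A B => insert (or A B) (A.subformulas ∪ B.subformulas)
  | imp A B => insert (imp A B) (A.subformulas ∪ B.subformulas)
  | ex x A => insert (ex x A) A.subformulas
  | all x A => insert (all x A) A.subformulas

/-- The conjunction of a finite list of formulas; the empty conjunction is the provable formula
`⊥ ⊃ ⊥`. -/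
def bigAnd : List (Formula L) → Formula L
  | [] => imp falsum falsum
  | A :: l => and A (bigAnd l)

/-- `nn E A` is `(A ⊃ E) ⊃ E`, the double negation of `A` relative to `E`. -/
def nn (E A : Formula L) : Formula L := imp (imp A E) E

end Formula

/-- Natural deduction: `Derives Ax Γ A` says that there is a derivation of `A` from the axioms `Ax`
with open assumptions among `Γ`. An axiom is not an open assumption. The calculus IQC itself
has no further axioms, `Ax = ∅`. -/
inductive Derives {L : FirstOrder.Language.{u, v}} (Ax : Set (Formula L)) :
    Set (Formula L) → Formula L → Prop
  | ax {Γ A} : A ∈ Ax → Derives Ax Γ A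
  | assumption {Γ A} : A ∈ Γ → Derives Ax Γ A
  | weaken {Γ Δ A} : Δ ⊆ Γ → Derives Ax Δ A → Derives Ax Γ A
  | andI {Γ A B} : Derives Ax Γ A → Derives Ax Γ B → Derives Ax Γ (.and A B)
  | andE₁ {Γ A B} : Derives Ax Γ (.and A B) → Derives Ax Γ A
  | andE₂ {Γ A B} : Derives Ax Γ (.and A B) → Derives Ax Γ B
  | orI₁ {Γ A B} : Derives Ax Γ A → Derives Ax Γ (.or A B)
  | orI₂ {Γ A B} : Derives Ax Γ B → Derives Ax Γ (.or A B)
  | orE {Γ A B C} : Derives Ax Γ (.or A B) → Derives Ax (insert A Γ) C →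
      Derives Ax (insert B Γ) C → Derives Ax Γ C
  | impI {Γ A B} : Derives Ax (insert A Γ) B → Derives Ax Γ (.imp A B)
  | impE {Γ A B} : Derives Ax Γ A → Derives Ax Γ (.imp A B) → Derives Ax Γ B
  | falsumE {Γ A} : Derives Ax Γ .falsum → Derives Ax Γ A
  | exI {Γ x A} (t : L.Term ℕ) : A.FreeFor x t → Derives Ax Γ (A.subst x t) →
      Derives Ax Γ (.ex x A)
  | exE {Γ Δ x A B} : Derives Ax Γ (.ex x A) → Derives Ax (insert A Δ) B → Δ ⊆ Γ →
      (∀ C ∈ Δ, x ∉ C.fv) → x ∉ B.fv → Derives Ax Γ B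
  | allI {Γ x A} : (∀ C ∈ Γ, x ∉ C.fv) → Derives Ax Γ A → Derives Ax Γ (.all x A)
  | allE {Γ x A} (t : L.Term ℕ) : A.FreeFor x t → Derives Ax Γ (.all x A) →
      Derives Ax Γ (A.subst x t)
  | eqI {Γ} (t : L.Term ℕ) : Derives Ax Γ (.eq t t)
  | eqSub {Γ} {x : ℕ} {A : Formula L} (s t : L.Term ℕ) : A.FreeFor x s → A.FreeFor x t →
      Derives Ax Γ (.eq s t) → Derives Ax Γ (A.subst x s) → Derives Ax Γ (A.subst x t)

/-- Theorems of IQC. -/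
def Provable {L : FirstOrder.Language.{u, v}} (A : Formula L) : Prop := Derives ∅ ∅ A

/-- Interderivability in IQC. -/
def Interderivable {L : FirstOrder.Language.{u, v}} (A B : Formula L) : Prop :=
  Derives ∅ {A} B ∧ Derives ∅ {B} A

end IQC

/-! ### Epistemic first-order calculus: classical first-order `S4` with equality -/

namespace EQC

/-- Formulas of the first-order language `L` with equality and the modal operator `□`. -/
inductive Formula (L : FirstOrder.Language.{u, v}) : Type (max u v)
  | falsum : Formula L
  | eq (s t : L.Term ℕ) : Formula L
  | rel {n : ℕ} (R : L.Relations n) (ts : Fin n → L.Term ℕ) : Formula L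
  | and (A B : Formula L) : Formula L
  | or (A B : Formula L) : Formula L
  | imp (A B : Formula L) : Formula L
  | ex (x : ℕ) (A : Formula L) : Formula L
  | all (x : ℕ) (A : Formula L) : Formula L
  | box (A : Formula L) : Formula L

namespace Formula

variable {L : FirstOrder.Language.{u, v}}

/-- The free variables of a formula. -/
def fv : Formula L → Finset ℕ
  | falsum => ∅
  | eq s t => s.varFinset ∪ t.varFinset
  | rel _ ts => Finset.univ.biUnion (fun i => (ts i).varFinset)
  | and A B => A.fv ∪ B.fv
  | or A B => A.fv ∪ B.fv
  | imp A B => A.fv ∪ B.fv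
  | ex x A => A.fv.erase x
  | all x A => A.fv.erase x
  | box A => A.fv

/-- `A.subst x t` is `A[t/x]`, as for formulas without `□`. -/
def subst (x : ℕ) (t : L.Term ℕ) : Formula L → Formula L
  | falsum => falsum
  | eq r s => eq (termSubst x t r) (termSubst x t s)
  | rel R ts => rel R (fun i => termSubst x t (ts i))
  | and A B => and (A.subst x t) (B.subst x t)
  | or A B => or (A.subst x t) (B.subst x t)
  | imp A B => imp (A.subst x t) (B.subst x t)
  | ex y A => if y = x then ex y A else ex y (A.subst x t)
  | all y A => if y = x then all y A else all y (A.subst x t)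
  | box A => box (A.subst x t)

/-- The term `t` is free for the variable `x` in a formula. -/
def FreeFor (x : ℕ) (t : L.Term ℕ) : Formula L → Prop
  | falsum => True
  | eq _ _ => True
  | rel _ _ => True
  | and A B => A.FreeFor x t ∧ B.FreeFor x t
  | or A B => A.FreeFor x t ∧ B.FreeFor x t
  | imp A B => A.FreeFor x t ∧ B.FreeFor x t
  | ex y A => x ∉ (ex y A).fv ∨ (y ∉ t.varFinset ∧ A.FreeFor x t)
  | all y A => x ∉ (all y A).fv ∨ (y ∉ t.varFinset ∧ A.FreeFor x t)
  | box A => A.FreeFor x t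

/-- Negation. -/
def neg (A : Formula L) : Formula L := imp A falsum

end Formula

/-- Natural deduction for classical `S4` with equality: the rules of IQC, with ex falso replaced by
reductio ad absurdum, and the two rules for `□`. As before, axioms are not open assumptions. -/
inductive Derives {L : FirstOrder.Language.{u, v}} (Ax : Set (Formula L)) :
    Set (Formula L) → Formula L → Prop
  | ax {Γ A} : A ∈ Ax → Derives Ax Γ A
  | assumption {Γ A} : A ∈ Γ → Derives Ax Γ A
  | weaken {Γ Δ A} : Δ ⊆ Γ → Derives Ax Δ A → Derives Ax Γ A
  | andI {Γ A B} : Derives Ax Γ A → Derives Ax Γ B → Derives Ax Γ (.and A B)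
  | andE₁ {Γ A B} : Derives Ax Γ (.and A B) → Derives Ax Γ A
  | andE₂ {Γ A B} : Derives Ax Γ (.and A B) → Derives Ax Γ B
  | orI₁ {Γ A B} : Derives Ax Γ A → Derives Ax Γ (.or A B)
  | orI₂ {Γ A B} : Derives Ax Γ B → Derives Ax Γ (.or A B)
  | orE {Γ A B C} : Derives Ax Γ (.or A B) → Derives Ax (insert A Γ) C →
      Derives Ax (insert B Γ) C → Derives Ax Γ C
  | impI {Γ A B} : Derives Ax (insert A Γ) B → Derives Ax Γ (.imp A B)
  | impE {Γ A B} : Derives Ax Γ A → Derives Ax Γ (.imp A B) → Derives Ax Γ B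
  | raa {Γ A} : Derives Ax (insert A.neg Γ) .falsum → Derives Ax Γ A
  | exI {Γ x A} (t : L.Term ℕ) : A.FreeFor x t → Derives Ax Γ (A.subst x t) →
      Derives Ax Γ (.ex x A)
  | exE {Γ Δ x A B} : Derives Ax Γ (.ex x A) → Derives Ax (insert A Δ) B → Δ ⊆ Γ →
      (∀ C ∈ Δ, x ∉ C.fv) → x ∉ B.fv → Derives Ax Γ B
  | allI {Γ x A} : (∀ C ∈ Γ, x ∉ C.fv) → Derives Ax Γ A → Derives Ax Γ (.all x A)
  | allE {Γ x A} (t : L.Term ℕ) : A.FreeFor x t → Derives Ax Γ (.all x A) →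
      Derives Ax Γ (A.subst x t)
  | eqI {Γ} (t : L.Term ℕ) : Derives Ax Γ (.eq t t)
  | eqSub {Γ} {x : ℕ} {A : Formula L} (s t : L.Term ℕ) : A.FreeFor x s → A.FreeFor x t →
      Derives Ax Γ (.eq s t) → Derives Ax Γ (A.subst x s) → Derives Ax Γ (A.subst x t)
  | boxI {Γ A} : (∀ C ∈ Γ, ∃ B, C = .box B) → Derives Ax Γ A → Derives Ax Γ (.box A)
  | boxE {Γ A} : Derives Ax Γ (.box A) → Derives Ax Γ A

/-- Theorems of EQC. -/
def Provable {L : FirstOrder.Language.{u, v}} (A : Formula L) : Prop := Derives ∅ ∅ A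

end EQC

/-! ### The translations -/

/-- The modified Rasiowa–Sikorski translation. -/
def IQC.Formula.boxRS {L : FirstOrder.Language.{u, v}} : IQC.Formula L → EQC.Formula L
  | .falsum => .falsum
  | .eq s t => .eq s t
  | .rel R ts => .box (.rel R ts)
  | .and A B => .and A.boxRS B.boxRS
  | .or A B => .or (.box A.boxRS) (.box B.boxRS)
  | .imp A B => .box (.imp (.box A.boxRS) (.box B.boxRS))
  | .ex x A => .ex x (.box A.boxRS)
  | .all x A => .all x A.boxRS

/-- The Flagg–Friedman translation relative to a finite set of formulas, given by a list `Γ`, and a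
formula `E`. Variables of `E` and of members of `Γ` may become bound by the quantifiers of the
translated formula: the clauses are read literally. -/
def EQC.Formula.flaggFriedman {L : FirstOrder.Language.{u, v}} (Γ : List (IQC.Formula L)) :
    EQC.Formula L → IQC.Formula L → IQC.Formula L
  | .falsum, E => .nn E .falsum
  | .eq s t, E => .nn E (.eq s t)
  | .rel R ts, E => .nn E (.rel R ts)
  | .and A B, E => .and (A.flaggFriedman Γ E) (B.flaggFriedman Γ E)
  | .or A B, E => .nn E (.or (A.flaggFriedman Γ E) (B.flaggFriedman Γ E))
  | .imp A B, E => .imp (A.flaggFriedman Γ E) (B.flaggFriedman Γ E)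
  | .ex x A, E => .nn E (.ex x (A.flaggFriedman Γ E))
  | .all x A, E => .all x (A.flaggFriedman Γ E)
  | .box A, E => .nn E (IQC.Formula.bigAnd (Γ.map fun C => A.flaggFriedman Γ C))

/-! ### Heyting arithmetic and epistemic arithmetic -/

/-- The function symbols of arithmetic, by arity. -/
inductive ArithFunc : ℕ → Type
  | zero : ArithFunc 0
  | succ : ArithFunc 1
  | add : ArithFunc 2
  | mul : ArithFunc 2

/-- The language of arithmetic: `0`, successor, `+`, `·`, and no relation symbol but equality. -/
def arith : FirstOrder.Language.{0, 0} := ⟨ArithFunc, fun _ => Empty⟩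

namespace arith

/-- The term `0`. -/
def zero : arith.Term ℕ := FirstOrder.Language.Term.func (l := 0) ArithFunc.zero ![]

/-- The successor of a term. -/
def succ (t : arith.Term ℕ) : arith.Term ℕ :=
  FirstOrder.Language.Term.func (l := 1) ArithFunc.succ ![t]

/-- The sum of two terms. -/
def add (s t : arith.Term ℕ) : arith.Term ℕ :=
  FirstOrder.Language.Term.func (l := 2) ArithFunc.add ![s, t]

/-- The product of two terms. -/
def mul (s t : arith.Term ℕ) : arith.Term ℕ :=
  FirstOrder.Language.Term.func (l := 2) ArithFunc.mul ![s, t]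

end arith

/-- The axioms of Heyting arithmetic: zero and successor, the defining equations of `+` and `·`
(for all terms), and induction for all formulas. -/
inductive HAAxiom : IQC.Formula arith → Prop
  | succ_ne_zero (t) : HAAxiom (.neg (.eq (arith.succ t) arith.zero))
  | succ_inj (s t) : HAAxiom (.imp (.eq (arith.succ s) (arith.succ t)) (.eq s t))
  | add_zero (t) : HAAxiom (.eq (arith.add t arith.zero) t)
  | add_succ (s t) : HAAxiom (.eq (arith.add s (arith.succ t)) (arith.succ (arith.add s t)))
  | mul_zero (t) : HAAxiom (.eq (arith.mul t arith.zero) arith.zero)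
  | mul_succ (s t) : HAAxiom (.eq (arith.mul s (arith.succ t)) (arith.add (arith.mul s t) s))
  | induction (x : ℕ) (A) : HAAxiom
      (.imp (.and (A.subst x arith.zero)
          (.all x (.imp A (A.subst x (arith.succ (FirstOrder.Language.Term.var x))))))
        (.all x A))

/-- The axioms of epistemic arithmetic: the same, with induction for all formulas of the modal
language. -/
inductive EAAxiom : EQC.Formula arith → Prop
  | succ_ne_zero (t) : EAAxiom (.neg (.eq (arith.succ t) arith.zero))
  | succ_inj (s t) : EAAxiom (.imp (.eq (arith.succ s) (arith.succ t)) (.eq s t))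
  | add_zero (t) : EAAxiom (.eq (arith.add t arith.zero) t)
  | add_succ (s t) : EAAxiom (.eq (arith.add s (arith.succ t)) (arith.succ (arith.add s t)))
  | mul_zero (t) : EAAxiom (.eq (arith.mul t arith.zero) arith.zero)
  | mul_succ (s t) : EAAxiom (.eq (arith.mul s (arith.succ t)) (arith.add (arith.mul s t) s))
  | induction (x : ℕ) (A) : EAAxiom
      (.imp (.and (A.subst x arith.zero)
          (.all x (.imp A (A.subst x (arith.succ (FirstOrder.Language.Term.var x))))))
        (.all x A))

/-- Theorems of Heyting arithmetic. -/
def HA.Provable (A : IQC.Formula arith) : Prop := IQC.Derives {B | HAAxiom B} ∅ A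

/-- Theorems of epistemic arithmetic. -/
def EA.Provable (A : EQC.Formula arith) : Prop := EQC.Derives {B | EAAxiom B} ∅ A

/-! ### Substitution and renaming of variables in terms -/

section Terms

variable {L : FirstOrder.Language.{u, v}}

open FirstOrder.Language

/-! For fixed `E`, the non-modal Flagg–Friedman clauses form a negative translation with `E` in the
place of ⊥, so they interpret classical logic in intuitionistic logic. Up to the outer double
negation the clause for □ does not depend on `E`: it asserts the translations for all `C ∈ Γ` at
once. This validates the S4 rules, whence `ParamSystem.soundness`.

Conversely, an intuitionistic formula is recovered from the translations of its Rasiowa–Sikorski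
image by Friedman's trick. With `E` chosen as the atom, disjunction or existential formula at hand
(for an implication, its consequent), the double negation relative to `E` collapses to `E` itself
(`derives_closedFF_boxRS`). So a modal proof of the image yields an intuitionistic proof of the
formula. The other direction is an induction on derivations in which all assumptions stay boxed
(`derives_boxRS_of_derives`).

The difficulty is capture: read literally, the quantifiers may bind free variables of `E`, and the
quantifier rules are no longer respected. The proof therefore uses `closedFF`, where an injective
`f` moves the variables of the modal derivation away from the parameters `ys` of `Γ`, and □
quantifies universally over `ys`. The members of `Γ` are the subformulas `B` with each variable `x`
replaced by a fresh `y x`. Under the equations `y x = x` such a copy is equivalent to `B`, and these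
equations can be discharged because `∃ y, y = x` is provable (`exists_paramSystem`).

The recovery argument asks only that subformulas be represented in `Γ`, not that capture be
excluded. So it also covers the literal translation, the case `f = id`, `ys = []`, which gives the
interderivability statement. For arithmetic it remains to check that axioms translate to theorems.
-/

theorem mem_varFinset_func {n m : ℕ} (F : L.Functions n) (ts : Fin n → L.Term ℕ) :
    m ∈ (Term.func F ts).varFinset ↔ ∃ i, m ∈ (ts i).varFinset := by
  simp [Term.varFinset]

theorem mem_varFinset_var {n m : ℕ} :
    m ∈ (Term.var n : L.Term ℕ).varFinset ↔ m = n := by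
  simp [Term.varFinset]

theorem termSubst_var (x y : ℕ) (s : L.Term ℕ) :
    termSubst x s (.var y) = if y = x then s else .var y := rfl

theorem termSubst_func (x : ℕ) (s : L.Term ℕ) {n : ℕ} (F : L.Functions n)
    (ts : Fin n → L.Term ℕ) :
    termSubst x s (.func F ts) = .func F (fun i => termSubst x s (ts i)) := rfl

theorem termSubst_of_notMem {x : ℕ} {s t : L.Term ℕ} (h : x ∉ t.varFinset) :
    termSubst x s t = t := by
  induction t with
  | var y =>
    rw [mem_varFinset_var] at h
    rw [termSubst_var, if_neg (Ne.symm h)]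
  | func F ts ih =>
    rw [mem_varFinset_func] at h
    rw [termSubst_func]
    congr 1
    funext i
    exact ih i fun hi => h ⟨i, hi⟩

theorem termSubst_self (x : ℕ) (t : L.Term ℕ) : termSubst x (.var x) t = t := by
  induction t with
  | var y => rw [termSubst_var]; split_ifs with h <;> simp [h]
  | func F ts ih => rw [termSubst_func]; congr 1; funext i; exact ih i

theorem mem_varFinset_termSubst {x y : ℕ} {s t : L.Term ℕ}
    (h : y ∈ (termSubst x s t).varFinset) :
    y ∈ s.varFinset ∨ (y ∈ t.varFinset ∧ y ≠ x) := by
  induction t with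
  | var z =>
    rw [termSubst_var] at h
    split_ifs at h with hz
    · exact .inl h
    · rw [mem_varFinset_var] at h ⊢
      exact .inr ⟨h, h ▸ hz⟩
  | func F ts ih =>
    rw [termSubst_func, mem_varFinset_func] at h
    obtain ⟨i, hi⟩ := h
    rw [mem_varFinset_func]
    rcases ih i hi with h | h
    · exact .inl h
    · exact .inr ⟨⟨i, h.1⟩, h.2⟩

theorem relabel_termSubst {f : ℕ → ℕ} (hf : f.Injective) (x : ℕ) (s t : L.Term ℕ) :
    (termSubst x s t).relabel f = termSubst (f x) (s.relabel f) (t.relabel f) := by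
  induction t with
  | var y =>
    rw [termSubst_var, Term.relabel, termSubst_var]
    by_cases h : y = x
    · simp [h]
    · rw [if_neg h, if_neg fun h' => h (hf h')]; rfl
  | func F ts ih =>
    simp only [termSubst_func, Term.relabel]
    congr 1
    funext i
    exact ih i

theorem mem_varFinset_relabel {f : ℕ → ℕ} {n : ℕ} {t : L.Term ℕ}
    (h : n ∈ (t.relabel f).varFinset) : ∃ m ∈ t.varFinset, f m = n := by
  induction t with
  | var y =>
    rw [Term.relabel, mem_varFinset_var] at h
    exact ⟨y, mem_varFinset_var.2 rfl, h.symm⟩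
  | func F ts ih =>
    rw [Term.relabel, mem_varFinset_func] at h
    obtain ⟨i, hi⟩ := h
    obtain ⟨m, hm, e⟩ := ih i hi
    exact ⟨m, (mem_varFinset_func _ _).2 ⟨i, hm⟩, e⟩

theorem relabel_eq_self {f : ℕ → ℕ} {t : L.Term ℕ} (h : ∀ n ∈ t.varFinset, f n = n) :
    t.relabel f = t := by
  induction t with
  | var y => rw [Term.relabel, h y (mem_varFinset_var.2 rfl)]
  | func F ts ih =>
    rw [Term.relabel]
    congr 1
    funext i
    exact ih i fun n hn => h n ((mem_varFinset_func _ _).2 ⟨i, hn⟩)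

end Terms

/-! ### Syntax of intuitionistic formulas: substitution, variables, subformulas -/

namespace IQC

variable {L : FirstOrder.Language.{u, v}}

namespace Formula

theorem mem_fv_rel {n m : ℕ} {R : L.Relations n} {ts : Fin n → L.Term ℕ} :
    m ∈ (rel R ts).fv ↔ ∃ i, m ∈ (ts i).varFinset := by
  simp [fv]

theorem subst_of_notMem {x : ℕ} {t : L.Term ℕ} {A : Formula L} (h : x ∉ A.fv) :
    A.subst x t = A := by
  induction A with
  | falsum => rfl
  | eq r s =>
    simp only [fv, Finset.mem_union, not_or] at h
    simp only [subst, termSubst_of_notMem h.1, termSubst_of_notMem h.2]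
  | rel R ts =>
    simp only [mem_fv_rel, not_exists] at h
    simp only [subst]
    congr 1
    funext i
    exact termSubst_of_notMem (h i)
  | and A B ihA ihB | or A B ihA ihB | imp A B ihA ihB =>
    simp only [fv, Finset.mem_union, not_or] at h
    simp only [subst, ihA h.1, ihB h.2]
  | ex y A ih | all y A ih =>
    simp only [fv, Finset.mem_erase, not_and] at h
    simp only [subst]
    split_ifs with hy
    · rfl
    · rw [ih (h (Ne.symm hy))]

theorem subst_self (x : ℕ) (A : Formula L) : A.subst x (.var x) = A := by
  induction A with
  | falsum => rfl
  | eq r s => simp only [subst, termSubst_self]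
  | rel R ts => simp only [subst, termSubst_self]
  | and A B ihA ihB | or A B ihA ihB | imp A B ihA ihB => simp only [subst, ihA, ihB]
  | ex y A ih | all y A ih => simp only [subst, ih, ite_self]

theorem freeFor_of_notMem {x : ℕ} {t : L.Term ℕ} {A : Formula L} (h : x ∉ A.fv) :
    A.FreeFor x t := by
  induction A with
  | falsum | eq r s | rel R ts => trivial
  | and A B ihA ihB | or A B ihA ihB | imp A B ihA ihB =>
    simp only [fv, Finset.mem_union, not_or] at h
    exact ⟨ihA h.1, ihB h.2⟩
  | ex y A ih | all y A ih => exact .inl h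

theorem freeFor_self (x : ℕ) (A : Formula L) : A.FreeFor x (.var x) := by
  induction A with
  | falsum | eq r s | rel R ts => trivial
  | and A B ihA ihB | or A B ihA ihB | imp A B ihA ihB => exact ⟨ihA, ihB⟩
  | ex y A ih | all y A ih =>
    by_cases h : y = x
    · exact .inl (by simp [fv, h])
    · exact .inr ⟨by rwa [mem_varFinset_var], ih⟩

theorem mem_fv_subst {x y : ℕ} {t : L.Term ℕ} {A : Formula L} (h : y ∈ (A.subst x t).fv) :
    y ∈ t.varFinset ∨ (y ∈ A.fv ∧ y ≠ x) := by
  induction A with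
  | falsum => simp [subst, fv] at h
  | eq r s =>
    simp only [subst, fv, Finset.mem_union] at h ⊢
    rcases h with h | h <;> rcases mem_varFinset_termSubst h with h | h <;> tauto
  | rel R ts =>
    simp only [subst, mem_fv_rel] at h ⊢
    obtain ⟨i, h⟩ := h
    rcases mem_varFinset_termSubst h with h | h
    · exact .inl h
    · exact .inr ⟨⟨i, h.1⟩, h.2⟩
  | and A B ihA ihB | or A B ihA ihB | imp A B ihA ihB =>
    simp only [subst, fv, Finset.mem_union] at h ⊢
    tauto
  | ex z A ih | all z A ih =>
    simp only [subst] at h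
    split_ifs at h with hz
    · simp only [fv, Finset.mem_erase] at h ⊢
      exact .inr ⟨h, hz ▸ h.1⟩
    · simp only [fv, Finset.mem_erase] at h ⊢
      rcases ih h.2 with h' | h' <;> tauto

/-- The bound variables of a formula. -/
def bv : Formula L → Finset ℕ
  | falsum => ∅
  | eq _ _ => ∅
  | rel _ _ => ∅
  | and A B => A.bv ∪ B.bv
  | or A B => A.bv ∪ B.bv
  | imp A B => A.bv ∪ B.bv
  | ex x A => insert x A.bv
  | all x A => insert x A.bv

theorem bv_subst (x : ℕ) (t : L.Term ℕ) (A : Formula L) : (A.subst x t).bv = A.bv := by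
  induction A with
  | falsum | eq r s | rel R ts => rfl
  | and A B ihA ihB | or A B ihA ihB | imp A B ihA ihB => simp only [subst, bv, ihA, ihB]
  | ex y A ih | all y A ih => simp only [subst]; split_ifs <;> simp only [bv, ih]

theorem freeFor_of_disjoint {x : ℕ} {t : L.Term ℕ} {A : Formula L}
    (h : ∀ y ∈ A.bv, y ∉ t.varFinset) : A.FreeFor x t := by
  induction A with
  | falsum | eq r s | rel R ts => trivial
  | and A B ihA ihB | or A B ihA ihB | imp A B ihA ihB =>
    simp only [bv, Finset.mem_union] at h
    exact ⟨ihA fun y hy => h y (.inl hy), ihB fun y hy => h y (.inr hy)⟩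
  | ex z A ih | all z A ih =>
    simp only [bv, Finset.mem_insert] at h
    exact .inr ⟨h z (.inl rfl), ih fun y hy => h y (.inr hy)⟩

/-- All variables, free or bound, of a formula. -/
def vars : Formula L → Finset ℕ
  | falsum => ∅
  | eq s t => s.varFinset ∪ t.varFinset
  | rel _ ts => Finset.univ.biUnion (fun i => (ts i).varFinset)
  | and A B => A.vars ∪ B.vars
  | or A B => A.vars ∪ B.vars
  | imp A B => A.vars ∪ B.vars
  | ex x A => insert x A.vars
  | all x A => insert x A.vars

theorem fv_subset_vars (A : Formula L) : A.fv ⊆ A.vars := by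
  induction A with
  | falsum | eq r s | rel R ts => exact Finset.Subset.refl _
  | and A B ihA ihB | or A B ihA ihB | imp A B ihA ihB => exact Finset.union_subset_union ihA ihB
  | ex y A ih | all y A ih =>
    exact (Finset.erase_subset _ _).trans (ih.trans (Finset.subset_insert _ _))

theorem bv_subset_vars (A : Formula L) : A.bv ⊆ A.vars := by
  induction A with
  | falsum | eq r s | rel R ts => exact Finset.empty_subset _
  | and A B ihA ihB | or A B ihA ihB | imp A B ihA ihB => exact Finset.union_subset_union ihA ihB
  | ex y A ih | all y A ih => exact Finset.insert_subset_insert _ ih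

theorem mem_subformulas_self (A : Formula L) : A ∈ A.subformulas := by
  cases A <;> simp [subformulas]

theorem finite_subformulas (A : Formula L) : A.subformulas.Finite := by
  induction A with
  | falsum | eq r s | rel R ts => exact Set.finite_singleton _
  | and A B ihA ihB | or A B ihA ihB | imp A B ihA ihB => exact (ihA.union ihB).insert _
  | ex y A ih | all y A ih => exact ih.insert _

theorem vars_subset_of_mem_subformulas {A B : Formula L} (h : B ∈ A.subformulas) :
    B.vars ⊆ A.vars := by
  induction A with
  | falsum | eq r s | rel R ts =>
    rw [Set.mem_singleton_iff.1 h]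
  | and A₁ A₂ ih₁ ih₂ | or A₁ A₂ ih₁ ih₂ | imp A₁ A₂ ih₁ ih₂ =>
    rcases h with rfl | h | h
    · exact Finset.Subset.refl _
    · exact (ih₁ h).trans Finset.subset_union_left
    · exact (ih₂ h).trans Finset.subset_union_right
  | ex y A ih | all y A ih =>
    rcases h with rfl | h
    · exact Finset.Subset.refl _
    · exact (ih h).trans (Finset.subset_insert _ _)

/-- `allList [x₁, …, xₙ] A` is `∀ x₁ … ∀ xₙ A`. -/
def allList : List ℕ → Formula L → Formula L
  | [], A => A
  | x :: l, A => all x (allList l A)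

theorem mem_fv_allList {l : List ℕ} {A : Formula L} {n : ℕ} :
    n ∈ (allList l A).fv ↔ n ∈ A.fv ∧ n ∉ l := by
  induction l with
  | nil => simp [allList]
  | cons x l ih => simp only [allList, fv, Finset.mem_erase, ih, List.mem_cons]; tauto

theorem subst_allList {l : List ℕ} {x : ℕ} (hx : x ∉ l) (t : L.Term ℕ) (A : Formula L) :
    (allList l A).subst x t = allList l (A.subst x t) := by
  induction l with
  | nil => rfl
  | cons y l ih =>
    rw [List.mem_cons, not_or] at hx
    rw [allList, subst, if_neg (Ne.symm hx.1), ih hx.2, allList]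

theorem freeFor_allList {l : List ℕ} {x : ℕ} {t : L.Term ℕ} {A : Formula L}
    (hl : ∀ y ∈ l, y ∉ t.varFinset) (h : A.FreeFor x t) : (allList l A).FreeFor x t := by
  induction l with
  | nil => exact h
  | cons y l ih =>
    rw [List.forall_mem_cons] at hl
    exact .inr ⟨hl.1, ih hl.2⟩

theorem mem_fv_bigAnd {l : List (Formula L)} {n : ℕ} :
    n ∈ (bigAnd l).fv ↔ ∃ A ∈ l, n ∈ A.fv := by
  induction l with
  | nil => simp [bigAnd, fv]
  | cons A l ih => simp [bigAnd, fv, ih]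

theorem subst_bigAnd (x : ℕ) (t : L.Term ℕ) (l : List (Formula L)) :
    (bigAnd l).subst x t = bigAnd (l.map (subst x t)) := by
  induction l with
  | nil => rfl
  | cons A l ih => simp only [bigAnd, subst, ih, List.map_cons]

theorem freeFor_bigAnd {x : ℕ} {t : L.Term ℕ} {l : List (Formula L)}
    (h : ∀ A ∈ l, A.FreeFor x t) : (bigAnd l).FreeFor x t := by
  induction l with
  | nil => exact ⟨trivial, trivial⟩
  | cons A l ih =>
    rw [List.forall_mem_cons] at h
    exact ⟨h.1, ih h.2⟩

theorem mem_fv_nn {E A : Formula L} {n : ℕ} : n ∈ (nn E A).fv ↔ n ∈ A.fv ∨ n ∈ E.fv := by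
  simp only [nn, fv, Finset.mem_union]; tauto

end Formula

/-! ### Derived rules of the intuitionistic calculus and relative double negation -/

namespace Derives

variable {Ax : Set (Formula L)} {Γ Δ : Set (Formula L)} {A B C E : Formula L}

open Formula

theorem wk (h : Derives Ax Γ A) : Derives Ax (insert B Γ) A := h.weaken (Set.subset_insert _ _)

theorem hyp : Derives Ax (insert A Γ) A := assumption (Set.mem_insert _ _)

theorem cut (h : Derives Ax Γ A) (h' : Derives Ax (insert A Γ) B) : Derives Ax Γ B :=
  impE h (impI h')

theorem of_singleton (h : Derives Ax {A} B) (hA : Derives Ax Γ A) : Derives Ax Γ B :=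
  hA.cut (h.weaken (Set.singleton_subset_iff.2 (Set.mem_insert _ _)))

theorem wk' (h : Derives Ax (insert A Γ) C) : Derives Ax (insert A (insert B Γ)) C :=
  h.weaken (Set.insert_subset_insert (Set.subset_insert _ _))

theorem ex_self {x : ℕ} (h : Derives Ax Γ A) : Derives Ax Γ (.ex x A) :=
  exI (.var x) (freeFor_self x A) (by rwa [subst_self])

theorem all_self {x : ℕ} (h : Derives Ax Γ (.all x A)) : Derives Ax Γ A := by
  have := allE (.var x) (freeFor_self x A) h
  rwa [subst_self] at this

/-- Every derivation uses finitely many assumptions. -/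
theorem exists_finite (h : Derives Ax Γ A) : ∃ Δ ⊆ Γ, Δ.Finite ∧ Derives Ax Δ A := by
  -- For rules that discharge `B`: delete `B` from the finite set found for the premise, and let the
  -- rule supply it again.
  have key : ∀ {Γ Δ : Set (Formula L)} {B : Formula L}, Δ ⊆ insert B Γ →
      Δ \ {B} ⊆ Γ ∧ Δ ⊆ insert B (Δ \ {B}) := by
    intro Γ Δ B h
    refine ⟨fun C hC => (h hC.1).resolve_left hC.2, fun C hC => ?_⟩
    by_cases hB : C = B
    · exact .inl hB
    · exact .inr ⟨hC, hB⟩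
  induction h with
  | ax h => exact ⟨∅, Set.empty_subset _, Set.finite_empty, .ax h⟩
  | @assumption _ A h =>
    exact ⟨{A}, Set.singleton_subset_iff.2 h, Set.finite_singleton _, .assumption rfl⟩
  | weaken hs _ ih =>
    obtain ⟨Δ, h1, h2, h3⟩ := ih
    exact ⟨Δ, h1.trans hs, h2, h3⟩
  | andI _ _ ih₁ ih₂ =>
    obtain ⟨Δ, h1, h2, h3⟩ := ih₁
    obtain ⟨Δ', h1', h2', h3'⟩ := ih₂
    exact ⟨Δ ∪ Δ', Set.union_subset h1 h1', h2.union h2',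
      .andI (h3.weaken Set.subset_union_left) (h3'.weaken Set.subset_union_right)⟩
  | andE₁ _ ih => obtain ⟨Δ, h1, h2, h3⟩ := ih; exact ⟨Δ, h1, h2, h3.andE₁⟩
  | andE₂ _ ih => obtain ⟨Δ, h1, h2, h3⟩ := ih; exact ⟨Δ, h1, h2, h3.andE₂⟩
  | orI₁ _ ih => obtain ⟨Δ, h1, h2, h3⟩ := ih; exact ⟨Δ, h1, h2, h3.orI₁⟩
  | orI₂ _ ih => obtain ⟨Δ, h1, h2, h3⟩ := ih; exact ⟨Δ, h1, h2, h3.orI₂⟩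
  | @orE Γ A B C _ _ _ ih ihA ihB =>
    obtain ⟨Δ, h1, h2, h3⟩ := ih
    obtain ⟨Δ₁, h1', h2', h3'⟩ := ihA
    obtain ⟨Δ₂, h1'', h2'', h3''⟩ := ihB
    obtain ⟨k1, k2⟩ := key h1'
    obtain ⟨l1, l2⟩ := key h1''
    refine ⟨Δ ∪ (Δ₁ \ {A} ∪ Δ₂ \ {B}), Set.union_subset h1 (Set.union_subset k1 l1),
      h2.union (h2'.sdiff.union h2''.sdiff), .orE (h3.weaken Set.subset_union_left)
        (h3'.weaken (k2.trans (Set.insert_subset_insert ?_)))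
        (h3''.weaken (l2.trans (Set.insert_subset_insert ?_)))⟩
    · exact Set.subset_union_left.trans Set.subset_union_right
    · exact Set.subset_union_right.trans Set.subset_union_right
  | @impI Γ A B _ ih =>
    obtain ⟨Δ, h1, h2, h3⟩ := ih
    obtain ⟨k1, k2⟩ := key h1
    exact ⟨Δ \ {A}, k1, h2.sdiff, .impI (h3.weaken k2)⟩
  | impE _ _ ih₁ ih₂ =>
    obtain ⟨Δ, h1, h2, h3⟩ := ih₁
    obtain ⟨Δ', h1', h2', h3'⟩ := ih₂
    exact ⟨Δ ∪ Δ', Set.union_subset h1 h1', h2.union h2',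
      .impE (h3.weaken Set.subset_union_left) (h3'.weaken Set.subset_union_right)⟩
  | falsumE _ ih => obtain ⟨Δ, h1, h2, h3⟩ := ih; exact ⟨Δ, h1, h2, h3.falsumE⟩
  | exI t hf _ ih => obtain ⟨Δ, h1, h2, h3⟩ := ih; exact ⟨Δ, h1, h2, h3.exI t hf⟩
  | @exE Γ Δ₀ x A B _ _ hs hx hB ih₁ ih₂ =>
    obtain ⟨Δ, h1, h2, h3⟩ := ih₁
    obtain ⟨Δ', h1', h2', h3'⟩ := ih₂
    obtain ⟨k1, k2⟩ := key h1'
    exact ⟨Δ ∪ Δ' \ {A}, Set.union_subset h1 (k1.trans hs), h2.union h2'.sdiff,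
      .exE (h3.weaken Set.subset_union_left) (h3'.weaken k2) Set.subset_union_right
        (fun C hC => hx C (k1 hC)) hB⟩
  | allI hx _ ih =>
    obtain ⟨Δ, h1, h2, h3⟩ := ih
    exact ⟨Δ, h1, h2, h3.allI fun C hC => hx C (h1 hC)⟩
  | allE t hf _ ih => obtain ⟨Δ, h1, h2, h3⟩ := ih; exact ⟨Δ, h1, h2, h3.allE t hf⟩
  | eqI t => exact ⟨∅, Set.empty_subset _, Set.finite_empty, .eqI t⟩
  | eqSub s t hs ht _ _ ih₁ ih₂ =>
    obtain ⟨Δ, h1, h2, h3⟩ := ih₁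
    obtain ⟨Δ', h1', h2', h3'⟩ := ih₂
    exact ⟨Δ ∪ Δ', Set.union_subset h1 h1', h2.union h2',
      .eqSub s t hs ht (h3.weaken Set.subset_union_left) (h3'.weaken Set.subset_union_right)⟩

/-- Simultaneous cut for a possibly infinite set of assumptions; finiteness of derivations reduces
it to finitely many single cuts. -/
theorem of_forall (h : Derives Ax Γ A) (hΔ : ∀ B ∈ Γ, Derives Ax Δ B) : Derives Ax Δ A := by
  obtain ⟨Γ', hs, hfin, h'⟩ := h.exists_finite
  have hΔ' : ∀ B ∈ Γ', Derives Ax Δ B := fun B hB => hΔ B (hs hB)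
  clear hs hΔ h
  induction Γ', hfin using Set.Finite.induction_on generalizing A with
  | empty => exact h'.weaken (Set.empty_subset _)
  | @insert B Γ' _ _ ih =>
    exact impE (hΔ' B (.inl rfl)) (ih (impI h') fun C hC => hΔ' C (.inr hC))

theorem bigAnd_intro {l : List (Formula L)} (h : ∀ A ∈ l, Derives Ax Γ A) :
    Derives Ax Γ (bigAnd l) := by
  induction l with
  | nil => exact impI hyp
  | cons A l ih =>
    rw [List.forall_mem_cons] at h
    exact andI h.1 (ih h.2)

theorem bigAnd_elim {l : List (Formula L)} (h : Derives Ax Γ (bigAnd l)) (hA : A ∈ l) :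
    Derives Ax Γ A := by
  induction l with
  | nil => simp at hA
  | cons B l ih =>
    rcases List.mem_cons.1 hA with rfl | hA
    · exact h.andE₁
    · exact ih h.andE₂ hA

theorem allList_intro {l : List ℕ} (hl : ∀ C ∈ Γ, ∀ y ∈ l, y ∉ C.fv) (h : Derives Ax Γ A) :
    Derives Ax Γ (allList l A) := by
  induction l with
  | nil => exact h
  | cons x l ih =>
    exact allI (fun C hC => hl C hC x List.mem_cons_self)
      (ih fun C hC y hy => hl C hC y (List.mem_cons_of_mem _ hy))

theorem allList_elim {l : List ℕ} (h : Derives Ax Γ (allList l A)) : Derives Ax Γ A := by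
  induction l with
  | nil => exact h
  | cons x l ih => exact ih h.all_self

theorem nn_intro (h : Derives Ax Γ A) : Derives Ax Γ (nn E A) := impI (impE h.wk hyp)

theorem nn_of (h : Derives Ax Γ E) : Derives Ax Γ (nn E A) := impI h.wk

theorem nn_elim (h : Derives Ax Γ (nn E A)) (h' : Derives Ax (insert A Γ) E) :
    Derives Ax Γ E := impE (impI h') h

/-- `nn E` behaves as a monad: to prove a double negation relative to `E`, an assumption doubly
negated relative to the same `E` may be used without its double negation. -/
theorem nn_bind (h : Derives Ax Γ (nn E A)) (h' : Derives Ax (insert A Γ) (nn E B)) :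
    Derives Ax Γ (nn E B) :=
  impI (nn_elim h.wk (impE (hyp.wk) (h'.weaken (Set.insert_subset_insert (Set.subset_insert _ _)))))

theorem nn_nn (h : Derives Ax Γ (nn E (nn E A))) : Derives Ax Γ (nn E A) := nn_bind h hyp

/-- A derivation from assumptions `B` yields one of `nn E A` from the assumptions `nn E B`. -/
theorem nn_context (h : Derives Ax Γ A) (hΔ : ∀ B ∈ Γ, Derives Ax Δ (nn E B)) :
    Derives Ax Δ (nn E A) := by
  obtain ⟨Γ', hs, hfin, h'⟩ := h.exists_finite
  have hΔ' : ∀ B ∈ Γ', Derives Ax Δ (nn E B) := fun B hB => hΔ B (hs hB)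
  clear hs hΔ h
  induction Γ', hfin using Set.Finite.induction_on generalizing A with
  | empty => exact nn_intro (h'.weaken (Set.empty_subset _))
  | @insert B Γ' _ _ ih =>
    have h1 := ih (impI h') fun C hC => hΔ' C (.inr hC)
    refine nn_bind h1 (nn_bind (hΔ' B (.inl rfl)).wk (nn_intro ?_))
    exact impE hyp hyp.wk

end Derives

end IQC

/-! ### The capture-free Flagg–Friedman translation and its soundness -/

namespace EQC

variable {L : FirstOrder.Language.{u, v}}

open IQC.Formula (nn bigAnd allList)

/-- A form of the Flagg–Friedman translation without capture of variables: the variables of the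
modal formula are renamed by `f`, and the parameters `ys` of the formulas in `Γ` are universally
quantified in the clause for `□`. -/
def Formula.closedFF (f : ℕ → ℕ) (ys : List ℕ) (Γ : List (IQC.Formula L)) :
    Formula L → IQC.Formula L → IQC.Formula L
  | .falsum, E => nn E .falsum
  | .eq s t, E => nn E (.eq (s.relabel f) (t.relabel f))
  | .rel R ts, E => nn E (.rel R fun i => (ts i).relabel f)
  | .and A B, E => .and (A.closedFF f ys Γ E) (B.closedFF f ys Γ E)
  | .or A B, E => nn E (.or (A.closedFF f ys Γ E) (B.closedFF f ys Γ E))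
  | .imp A B, E => .imp (A.closedFF f ys Γ E) (B.closedFF f ys Γ E)
  | .ex x A, E => nn E (.ex (f x) (A.closedFF f ys Γ E))
  | .all x A, E => .all (f x) (A.closedFF f ys Γ E)
  | .box A, E => nn E (allList ys (bigAnd (Γ.map fun C => A.closedFF f ys Γ C)))

/-- The interpretation of `□ A` before it is made stable. -/
def Formula.interiorFF (f : ℕ → ℕ) (ys : List ℕ) (Γ : List (IQC.Formula L)) (A : Formula L) :
    IQC.Formula L :=
  allList ys (bigAnd (Γ.map fun C => A.closedFF f ys Γ C))

variable {Ax : Set (IQC.Formula L)} {Θ : Set (IQC.Formula L)} {f : ℕ → ℕ} {ys : List ℕ}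
  {Γ : List (IQC.Formula L)}

theorem Formula.closedFF_id_nil (A : Formula L) (E : IQC.Formula L) :
    A.closedFF id [] Γ E = A.flaggFriedman Γ E := by
  induction A generalizing E with
  | falsum => rfl
  | eq s t => simp only [closedFF, flaggFriedman, FirstOrder.Language.Term.relabel_id]
  | rel R ts => simp only [closedFF, flaggFriedman, FirstOrder.Language.Term.relabel_id]
  | and A B ihA ihB | or A B ihA ihB | imp A B ihA ihB =>
    simp only [closedFF, flaggFriedman, ihA, ihB]
  | ex x A ih | all x A ih => simp only [closedFF, flaggFriedman, ih, id]
  | box A ih => simp only [closedFF, flaggFriedman, ih, allList]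

theorem Formula.interiorFF_id_nil (A : Formula L) :
    A.interiorFF id [] Γ = bigAnd (Γ.map fun C => A.flaggFriedman Γ C) := by
  simp only [interiorFF, closedFF_id_nil, allList]

theorem notMem_fv_interiorFF (A : Formula L) {y : ℕ} (hy : y ∈ ys) :
    y ∉ (A.interiorFF f ys Γ).fv := fun h => (IQC.Formula.mem_fv_allList.1 h).2 hy

/-- The right-hand side does not mention the parameter `E` of the translation. It can be reached
only from assumptions free of `ys`, in particular from other interiors. -/
theorem interiorFF_intro {A : Formula L} (hΘ : ∀ C ∈ Θ, ∀ y ∈ ys, y ∉ C.fv)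
    (h : ∀ C ∈ Γ, IQC.Derives Ax Θ (A.closedFF f ys Γ C)) :
    IQC.Derives Ax Θ (A.interiorFF f ys Γ) :=
  .allList_intro hΘ (.bigAnd_intro fun B hB => by
    obtain ⟨C, hC, rfl⟩ := List.mem_map.1 hB
    exact h C hC)

theorem interiorFF_elim {A : Formula L} {C : IQC.Formula L} (hC : C ∈ Γ)
    (h : IQC.Derives Ax Θ (A.interiorFF f ys Γ)) : IQC.Derives Ax Θ (A.closedFF f ys Γ C) :=
  .bigAnd_elim (.allList_elim h) (List.mem_map.2 ⟨C, hC, rfl⟩)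


/-- `f` is injective with range disjoint from `ys`, and `ys` contains the free variables of the
members of `Γ`. -/
structure ParamSystem (f : ℕ → ℕ) (ys : List ℕ) (Γ : List (IQC.Formula L)) : Prop where
  inj : f.Injective
  notMem : ∀ n, f n ∉ ys
  fv_mem : ∀ C ∈ Γ, ∀ n ∈ C.fv, n ∈ ys

namespace ParamSystem

theorem notMem_fv (hP : ParamSystem f ys Γ) {E : IQC.Formula L} (hE : E ∈ Γ) (n : ℕ) :
    f n ∉ E.fv := fun h => hP.notMem n (hP.fv_mem E hE _ h)

/-- The formulas in `Γ` contribute only free variables from `ys`, which `f` avoids. Hence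
eigenvariable conditions survive the translation. -/
theorem mem_fv_closedFF (hP : ParamSystem f ys Γ) {A : Formula L} {E : IQC.Formula L} (hE : E ∈ Γ)
    {n : ℕ} (h : f n ∈ (A.closedFF f ys Γ E).fv) : n ∈ A.fv := by
  have hn := hP.notMem_fv hE n
  have hterm : ∀ t : L.Term ℕ, f n ∈ (t.relabel f).varFinset → n ∈ t.varFinset := by
    intro t ht
    obtain ⟨m, hm, e⟩ := mem_varFinset_relabel ht
    exact hP.inj e ▸ hm
  induction A generalizing E with
  | falsum => simp [Formula.closedFF, IQC.Formula.mem_fv_nn, IQC.Formula.fv, hn] at h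
  | eq s t =>
    simp only [Formula.closedFF, IQC.Formula.mem_fv_nn, IQC.Formula.fv, hn, Finset.mem_union,
      or_false, Formula.fv] at h ⊢
    exact h.imp (hterm s) (hterm t)
  | rel R ts =>
    simp only [Formula.closedFF, IQC.Formula.mem_fv_nn, IQC.Formula.mem_fv_rel, hn,
      or_false] at h
    obtain ⟨i, hi⟩ := h
    simp only [Formula.fv, Finset.mem_biUnion, Finset.mem_univ, true_and]
    exact ⟨i, hterm _ hi⟩
  | and A B ihA ihB | imp A B ihA ihB =>
    simp only [Formula.closedFF, IQC.Formula.fv, Finset.mem_union, Formula.fv] at h ⊢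
    exact h.imp (ihA hE · hn) (ihB hE · hn)
  | or A B ihA ihB =>
    simp only [Formula.closedFF, IQC.Formula.mem_fv_nn, hn, or_false, IQC.Formula.fv,
      Finset.mem_union, Formula.fv] at h ⊢
    exact h.imp (ihA hE · hn) (ihB hE · hn)
  | ex x A ih =>
    simp only [Formula.closedFF, IQC.Formula.mem_fv_nn, hn, or_false, IQC.Formula.fv,
      Finset.mem_erase, Formula.fv] at h ⊢
    exact ⟨fun e => h.1 (e ▸ rfl), ih hE h.2 hn⟩
  | all x A ih =>
    simp only [Formula.closedFF, IQC.Formula.fv, Finset.mem_erase, Formula.fv] at h ⊢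
    exact ⟨fun e => h.1 (e ▸ rfl), ih hE h.2 hn⟩
  | box A ih =>
    simp only [Formula.closedFF, IQC.Formula.mem_fv_nn, hn, or_false, IQC.Formula.mem_fv_allList,
      IQC.Formula.mem_fv_bigAnd, List.mem_map] at h
    obtain ⟨⟨_, ⟨C, hC, rfl⟩, h⟩, -⟩ := h
    exact ih hC h (hP.notMem_fv hC n)

/-- This is where separation of variables pays off: `f x` does not occur free in any member of `Γ`,
so substitution passes through every inserted copy of `E` and through the quantifiers over `ys`. -/
theorem closedFF_subst (hP : ParamSystem f ys Γ) (x : ℕ) (t : L.Term ℕ) (A : Formula L)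
    {E : IQC.Formula L} (hE : E ∈ Γ) :
    (A.subst x t).closedFF f ys Γ E = (A.closedFF f ys Γ E).subst (f x) (t.relabel f) := by
  have hx := IQC.Formula.subst_of_notMem (t := t.relabel f) (hP.notMem_fv hE x)
  induction A generalizing E with
  | falsum => simp only [Formula.subst, Formula.closedFF, nn, IQC.Formula.subst, hx]
  | eq r s =>
    simp only [Formula.subst, Formula.closedFF, nn, IQC.Formula.subst, hx,
      relabel_termSubst hP.inj]
  | rel R ts =>
    simp only [Formula.subst, Formula.closedFF, nn, IQC.Formula.subst, hx,
      relabel_termSubst hP.inj]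
  | and A B ihA ihB | or A B ihA ihB | imp A B ihA ihB =>
    simp only [Formula.subst, Formula.closedFF, nn, IQC.Formula.subst, hx, ihA hE hx, ihB hE hx]
  | ex y A ih | all y A ih =>
    by_cases h : y = x
    · simp only [Formula.subst, Formula.closedFF, nn, IQC.Formula.subst, hx, h, if_true]
    · have h' : f y ≠ f x := fun e => h (hP.inj e)
      simp only [Formula.subst, Formula.closedFF, nn, IQC.Formula.subst, hx, h, h', if_false,
        ih hE hx]
  | box A ih =>
    simp only [Formula.subst, Formula.closedFF, nn, IQC.Formula.subst, hx,
      IQC.Formula.subst_allList (hP.notMem x), IQC.Formula.subst_bigAnd, List.map_map]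
    have : (Γ.map fun C => (A.subst x t).closedFF f ys Γ C) =
        Γ.map (IQC.Formula.subst (f x) (t.relabel f) ∘ fun C => A.closedFF f ys Γ C) :=
      List.map_congr_left fun C hC =>
        ih hC (IQC.Formula.subst_of_notMem (hP.notMem_fv hC x))
    rw [this]

theorem freeFor_closedFF (hP : ParamSystem f ys Γ) {x : ℕ} {t : L.Term ℕ} {A : Formula L}
    (h : A.FreeFor x t) {E : IQC.Formula L} (hE : E ∈ Γ) :
    (A.closedFF f ys Γ E).FreeFor (f x) (t.relabel f) := by
  have hx := IQC.Formula.freeFor_of_notMem (t := t.relabel f) (hP.notMem_fv hE x)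
  have hq : ∀ y (A : Formula L), ∀ E ∈ Γ,
      (x ∉ A.fv.erase y ∨ (y ∉ t.varFinset ∧
        (A.closedFF f ys Γ E).FreeFor (f x) (t.relabel f))) →
      f x ∉ (A.closedFF f ys Γ E).fv.erase (f y) ∨ (f y ∉ (t.relabel f).varFinset ∧
        (A.closedFF f ys Γ E).FreeFor (f x) (t.relabel f)) := by
    rintro y A E hE (h | h)
    · left
      simp only [Finset.mem_erase, not_and] at h ⊢
      exact fun h1 h2 => h (fun e => h1 (e ▸ rfl)) (hP.mem_fv_closedFF hE h2)
    · right
      refine ⟨fun h' => h.1 ?_, h.2⟩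
      obtain ⟨m, hm, e⟩ := mem_varFinset_relabel h'
      exact hP.inj e ▸ hm
  induction A generalizing E with
  | falsum | eq r s | rel R ts => exact ⟨⟨trivial, hx⟩, hx⟩
  | and A B ihA ihB | imp A B ihA ihB => exact ⟨ihA h.1 hE hx, ihB h.2 hE hx⟩
  | or A B ihA ihB => exact ⟨⟨⟨ihA h.1 hE hx, ihB h.2 hE hx⟩, hx⟩, hx⟩
  | ex y A ih =>
    exact ⟨⟨hq y A E hE (h.imp_right fun h => ⟨h.1, ih h.2 hE hx⟩), hx⟩, hx⟩
  | all y A ih =>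
    exact hq y A E hE (h.imp_right fun h => ⟨h.1, ih h.2 hE hx⟩)
  | box A ih =>
    refine ⟨⟨IQC.Formula.freeFor_allList ?_ (IQC.Formula.freeFor_bigAnd ?_), hx⟩, hx⟩
    · intro y hy h'
      obtain ⟨m, -, e⟩ := mem_varFinset_relabel h'
      exact hP.notMem m (e ▸ hy)
    · intro B hB
      obtain ⟨C, hC, rfl⟩ := List.mem_map.1 hB
      exact ih h hC (IQC.Formula.freeFor_of_notMem (hP.notMem_fv hC x))

open IQC.Derives in
/-- Translated formulas are stable under double negation relative to the parameter. -/
theorem stable (hP : ParamSystem f ys Γ) (A : Formula L) {E : IQC.Formula L} (hE : E ∈ Γ)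
    (h : IQC.Derives Ax Θ (nn E (A.closedFF f ys Γ E))) :
    IQC.Derives Ax Θ (A.closedFF f ys Γ E) := by
  induction A generalizing Θ with
  | falsum | eq s t | rel R ts | or A B _ _ | ex x A _ | box A _ => exact nn_nn h
  | and A B ihA ihB =>
    exact andI (ihA (nn_bind h (nn_intro hyp.andE₁))) (ihB (nn_bind h (nn_intro hyp.andE₂)))
  | imp A B _ ihB => exact impI (ihB (nn_bind h.wk (nn_intro (impE hyp.wk hyp))))
  | all x A ih =>
    -- The context may contain `f x` free, so the generalisation is made over the single assumption
    -- `nn E (∀ …)`, where `f x` is not free, and then cut in.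
    refine of_singleton (allI ?_ (ih (nn_bind (assumption rfl) (nn_intro hyp.all_self)))) h
    intro C hC hx
    rw [Set.mem_singleton_iff.1 hC, IQC.Formula.mem_fv_nn] at hx
    rcases hx with hx | hx
    · simp [IQC.Formula.fv] at hx
    · exact hP.notMem_fv hE x hx

/-- By stability, a double negation relative to `E` can be stripped from an assumption whenever the
goal is a translated formula. This handles ∨, ∃, = and □ eliminations. -/
theorem bind (hP : ParamSystem f ys Γ) {A : Formula L} {B E : IQC.Formula L} (hE : E ∈ Γ)
    (h : IQC.Derives Ax Θ (nn E B))
    (h' : IQC.Derives Ax (insert B Θ) (A.closedFF f ys Γ E)) :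
    IQC.Derives Ax Θ (A.closedFF f ys Γ E) :=
  hP.stable A hE (.nn_bind h (.nn_intro h'))

open IQC.Derives in
/-- Soundness of the translation. -/
theorem soundness (hP : ParamSystem f ys Γ) {Ax' : Set (Formula L)}
    (hAx : ∀ A ∈ Ax', ∀ E ∈ Γ, IQC.Derives Ax ∅ (A.closedFF f ys Γ E))
    {Δ : Set (Formula L)} {A : Formula L} (h : Derives Ax' Δ A) :
    ∀ E ∈ Γ, IQC.Derives Ax ((fun B => B.closedFF f ys Γ E) '' Δ) (A.closedFF f ys Γ E) := by
  induction h with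
  | ax h => exact fun E hE => (hAx _ h E hE).weaken (Set.empty_subset _)
  | assumption h => exact fun E hE => .assumption (Set.mem_image_of_mem _ h)
  | weaken hs _ ih => exact fun E hE => (ih E hE).weaken (Set.image_mono hs)
  | andI _ _ ih₁ ih₂ => exact fun E hE => .andI (ih₁ E hE) (ih₂ E hE)
  | andE₁ _ ih => exact fun E hE => .andE₁ (ih E hE)
  | andE₂ _ ih => exact fun E hE => .andE₂ (ih E hE)
  | orI₁ _ ih => exact fun E hE => nn_intro (.orI₁ (ih E hE))
  | orI₂ _ ih => exact fun E hE => nn_intro (.orI₂ (ih E hE))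
  | orE _ _ _ ih ihA ihB =>
    intro E hE
    have hA := ihA E hE
    have hB := ihB E hE
    rw [Set.image_insert_eq] at hA hB
    exact hP.bind hE (ih E hE) (.orE hyp
      (hA.weaken (Set.insert_subset_insert (Set.subset_insert _ _)))
      (hB.weaken (Set.insert_subset_insert (Set.subset_insert _ _))))
  | impI _ ih =>
    intro E hE
    have := ih E hE
    rw [Set.image_insert_eq] at this
    exact .impI this
  | impE _ _ ih₁ ih₂ => exact fun E hE => .impE (ih₁ E hE) (ih₂ E hE)
  | @raa Δ A _ ih =>
    intro E hE
    have := ih E hE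
    rw [Set.image_insert_eq] at this
    -- The translation of ⊥ is equivalent to `E`. Thus a refutation of the translated formula
    -- relative to `E` provides the translated assumption `¬A`, and the translated ⊥ then gives `E`.
    refine hP.stable A hE (.impI (nn_elim (A := .falsum) (.cut ?_ this.wk') hyp.falsumE))
    exact .impI (nn_of (.impE hyp hyp.wk))
  | @exI Δ x A t hf _ ih =>
    intro E hE
    have := ih E hE
    rw [hP.closedFF_subst x t A hE] at this
    exact nn_intro (.exI _ (hP.freeFor_closedFF hf hE) this)
  | @exE Γ₀ Δ x A B _ _ hs hx hB ih₁ ih₂ =>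
    intro E hE
    have h₂ := ih₂ E hE
    rw [Set.image_insert_eq] at h₂
    refine hP.bind hE (ih₁ E hE) (.exE hyp h₂
      ((Set.image_mono hs).trans (Set.subset_insert _ _)) ?_
      fun h => hB (hP.mem_fv_closedFF hE h))
    rintro _ ⟨C, hC, rfl⟩ h
    exact hx C hC (hP.mem_fv_closedFF hE h)
  | allI hx _ ih =>
    intro E hE
    refine .allI ?_ (ih E hE)
    rintro _ ⟨C, hC, rfl⟩ h
    exact hx C hC (hP.mem_fv_closedFF hE h)
  | @allE Δ x A t hf _ ih =>
    intro E hE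
    rw [hP.closedFF_subst x t A hE]
    exact .allE _ (hP.freeFor_closedFF hf hE) (ih E hE)
  | eqI t => exact fun E hE => nn_intro (.eqI _)
  | @eqSub Δ x A s t hs ht _ _ ih₁ ih₂ =>
    intro E hE
    have h₂ := ih₂ E hE
    refine hP.bind hE (ih₁ E hE) ?_
    rw [hP.closedFF_subst _ _ _ hE] at h₂ ⊢
    exact .eqSub _ _ (hP.freeFor_closedFF hs hE) (hP.freeFor_closedFF ht hE) hyp h₂.wk
  | @boxI Δ A hΔ _ ih =>
    intro E hE
    -- Work with the interiors of the assumptions `□B` in place of their double negations. They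
    -- imply the translated assumptions for every `C ∈ Γ`, so the induction hypothesis at all `C`
    -- yields the interior of `A`; the double negation relative to `E` is restored at the end.
    refine nn_context (Γ := {C | ∃ B : Formula L, B.box ∈ Δ ∧ B.interiorFF f ys Γ = C})
      (interiorFF_intro ?_ fun C hC => ?_) ?_
    · rintro _ ⟨B, -, rfl⟩ y hy
      exact notMem_fv_interiorFF B hy
    · refine (ih C hC).of_forall ?_
      rintro _ ⟨D, hD, rfl⟩
      obtain ⟨B, rfl⟩ := hΔ D hD
      exact nn_intro (.assumption ⟨B, hD, rfl⟩)
    · rintro _ ⟨B, hB, rfl⟩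
      exact .assumption ⟨_, hB, rfl⟩
  | boxE _ ih => exact fun E hE => hP.bind hE (ih E hE) (interiorFF_elim hE hyp)

end ParamSystem

end EQC

/-! ### Recovering a formula from the translations of its Rasiowa–Sikorski image -/

namespace EQC

variable {L : FirstOrder.Language.{u, v}}

open IQC.Formula (nn bigAnd allList)

variable {Ax : Set (IQC.Formula L)} {f : ℕ → ℕ} {ys : List ℕ} {Γ : List (IQC.Formula L)}

/-- `Γ` contains a formula whose equivalence with `B` may be assumed in derivations in whose
assumptions and conclusion the variables `ys` are not free. -/
def Represents (Ax : Set (IQC.Formula L)) (ys : List ℕ) (Γ : List (IQC.Formula L))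
    (B : IQC.Formula L) : Prop :=
  ∃ E ∈ Γ, (∀ n ∈ E.fv, n ∈ B.fv ∨ n ∈ ys) ∧
    ∀ (Δ : Set (IQC.Formula L)) (D : IQC.Formula L), (∀ C ∈ Δ, ∀ y ∈ ys, y ∉ C.fv) →
      (∀ y ∈ ys, y ∉ D.fv) →
      IQC.Derives Ax (insert (.imp B E) (insert (.imp E B) Δ)) D → IQC.Derives Ax Δ D

open IQC.Derives in
/-- A formula all of whose subformulas are represented in `Γ` implies all translations of its
Rasiowa–Sikorski translation and is implied by their conjunction. -/
theorem derives_closedFF_boxRS (A : IQC.Formula L) (hv : ∀ n ∈ A.vars, f n = n ∧ n ∉ ys)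
    (hΓ : ∀ B ∈ A.subformulas, Represents Ax ys Γ B) :
    (∀ E, IQC.Derives Ax {A} (A.boxRS.closedFF f ys Γ E)) ∧
      IQC.Derives Ax {A.boxRS.interiorFF f ys Γ} A := by
  have hterm : ∀ t : L.Term ℕ, (∀ n ∈ t.varFinset, f n = n ∧ n ∉ ys) → t.relabel f = t :=
    fun t ht => relabel_eq_self fun n hn => (ht n hn).1
  have hfv : ∀ B : IQC.Formula L, (∀ n ∈ B.vars, f n = n ∧ n ∉ ys) → ∀ y ∈ ys, y ∉ B.fv :=
    fun B hB y hy h => (hB y (B.fv_subset_vars h)).2 hy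
  have hint : ∀ M : Formula L, ∀ y ∈ ys, y ∉ (M.interiorFF f ys Γ).fv :=
    fun M y hy => notMem_fv_interiorFF M hy
  have intro_int : ∀ B : IQC.Formula L, (∀ n ∈ B.vars, f n = n ∧ n ∉ ys) →
      (∀ E, IQC.Derives Ax {B} (B.boxRS.closedFF f ys Γ E)) →
      IQC.Derives Ax {B} (B.boxRS.interiorFF f ys Γ) := fun B hB h =>
    interiorFF_intro (fun C hC => by rw [Set.mem_singleton_iff.1 hC]; exact hfv B hB)
      fun C _ => h C
  have int_elim : ∀ (M : Formula L) {E : IQC.Formula L} {Θ : Set (IQC.Formula L)}, E ∈ Γ →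
      M.interiorFF f ys Γ ∈ Θ → IQC.Derives Ax Θ (M.closedFF f ys Γ E) :=
    fun M _ _ hE h => interiorFF_elim hE (.assumption h)
  have elim : ∀ {B D : IQC.Formula L} {Θ : Set (IQC.Formula L)}, IQC.Derives Ax Θ (.imp B D) →
      IQC.Derives Ax Θ B → IQC.Derives Ax Θ D := fun h h' => .impE h' h
  induction A with
  | falsum =>
    refine ⟨fun E => nn_intro (.assumption rfl), ?_⟩
    -- Take `E` equivalent to the formula to be proved; then the double negation relative to `E` can
    -- be eliminated. The same choice works for atoms, ∨ and ∃.
    obtain ⟨E, hE, -, hel⟩ := hΓ _ (IQC.Formula.mem_subformulas_self _)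
    refine hel _ _ (by simpa using hint _) (hfv _ hv) ?_
    refine elim hyp.wk (nn_elim (int_elim IQC.Formula.falsum.boxRS hE (by simp)) ?_)
    exact elim hyp.wk hyp
  | eq s t =>
    simp only [IQC.Formula.vars, Finset.mem_union] at hv
    have hs := hterm s fun n hn => hv n (.inl hn)
    have ht := hterm t fun n hn => hv n (.inr hn)
    have e : ∀ E, (IQC.Formula.eq s t).boxRS.closedFF f ys Γ E = nn E (.eq s t) := by
      intro E
      simp only [IQC.Formula.boxRS, Formula.closedFF, hs, ht]
    refine ⟨fun E => e E ▸ nn_intro (.assumption rfl), ?_⟩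
    obtain ⟨E, hE, -, hel⟩ := hΓ _ (IQC.Formula.mem_subformulas_self _)
    refine hel _ _ (by simpa using hint _) (hfv _ (by simpa [IQC.Formula.vars] using hv)) ?_
    have := int_elim (IQC.Formula.eq s t).boxRS hE (Θ := {IQC.Formula.imp (.eq s t) E,
      .imp E (.eq s t), (IQC.Formula.eq s t).boxRS.interiorFF f ys Γ}) (by simp)
    rw [e] at this
    exact elim hyp.wk (nn_elim this (elim hyp.wk hyp))
  | @rel n R ts =>
    have hts : (fun i => (ts i).relabel f) = ts := by
      funext i
      refine hterm _ fun n hn => hv n ?_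
      simp only [IQC.Formula.vars, Finset.mem_biUnion, Finset.mem_univ, true_and]
      exact ⟨i, hn⟩
    have e : ∀ E, (Formula.rel R ts).closedFF f ys Γ E = nn E (.rel R ts) := by
      intro E
      simp only [Formula.closedFF, hts]
    refine ⟨fun E => nn_intro (interiorFF_intro ?_ fun C _ => ?_), ?_⟩
    · intro C hC
      rw [Set.mem_singleton_iff.1 hC]
      exact hfv _ hv
    · rw [e]
      exact nn_intro (.assumption rfl)
    · obtain ⟨E, hE, -, hel⟩ := hΓ _ (IQC.Formula.mem_subformulas_self _)
      refine hel _ _ (by simpa using hint _) (hfv _ hv) ?_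
      refine elim hyp.wk (nn_elim (int_elim (IQC.Formula.rel R ts).boxRS hE (by simp)) ?_)
      have := fun Θ => int_elim (Formula.rel R ts) hE
        (Set.mem_insert ((Formula.rel R ts).interiorFF f ys Γ) Θ)
      simp only [e] at this
      exact nn_elim (this _) (elim hyp.wk.wk hyp)
  | and A B ihA ihB =>
    simp only [IQC.Formula.vars, Finset.mem_union] at hv
    obtain ⟨hA, hA'⟩ := ihA (fun n hn => hv n (.inl hn)) fun C hC => hΓ C (.inr (.inl hC))
    obtain ⟨hB, hB'⟩ := ihB (fun n hn => hv n (.inr hn)) fun C hC => hΓ C (.inr (.inr hC))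
    refine ⟨fun E => .andI (of_singleton (hA E) (.andE₁ (.assumption rfl)))
      (of_singleton (hB E) (.andE₂ (.assumption rfl))), ?_⟩
    have h1 : ∀ C ∈ ({(A.and B).boxRS.interiorFF f ys Γ} : Set (IQC.Formula L)),
        ∀ y ∈ ys, y ∉ C.fv := by simpa using hint _
    exact .andI
      (of_singleton hA' (interiorFF_intro h1 fun C hC =>
        .andE₁ (interiorFF_elim (A := (A.and B).boxRS) hC (.assumption rfl))))
      (of_singleton hB' (interiorFF_intro h1 fun C hC =>
        .andE₂ (interiorFF_elim (A := (A.and B).boxRS) hC (.assumption rfl))))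
  | or A B ihA ihB =>
    have hv' := hv
    simp only [IQC.Formula.vars, Finset.mem_union] at hv
    have hvA := fun n hn => hv n (.inl hn)
    have hvB := fun n hn => hv n (.inr hn)
    obtain ⟨hA, hA'⟩ := ihA hvA fun C hC => hΓ C (.inr (.inl hC))
    obtain ⟨hB, hB'⟩ := ihB hvB fun C hC => hΓ C (.inr (.inr hC))
    refine ⟨fun E => nn_intro (.orE (.assumption rfl)
      (.orI₁ (nn_intro (of_singleton (intro_int A hvA hA) hyp)))
      (.orI₂ (nn_intro (of_singleton (intro_int B hvB hB) hyp)))), ?_⟩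
    obtain ⟨E, hE, -, hel⟩ := hΓ _ (IQC.Formula.mem_subformulas_self _)
    refine hel _ _ (by simpa using hint _) (hfv _ hv') ?_
    refine elim hyp.wk (nn_elim (int_elim (A.or B).boxRS hE (by simp)) (.orE hyp ?_ ?_))
    · exact nn_elim hyp (elim hyp.wk.wk.wk (.orI₁ (of_singleton hA' hyp)))
    · exact nn_elim hyp (elim hyp.wk.wk.wk (.orI₂ (of_singleton hB' hyp)))
  | imp A B ihA ihB =>
    have hv' := hv
    simp only [IQC.Formula.vars, Finset.mem_union] at hv
    have hvA := fun n hn => hv n (.inl hn)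
    have hvB := fun n hn => hv n (.inr hn)
    obtain ⟨hA, hA'⟩ := ihA hvA fun C hC => hΓ C (.inr (.inl hC))
    obtain ⟨hB, hB'⟩ := ihB hvB fun C hC => hΓ C (.inr (.inr hC))
    refine ⟨fun E => nn_intro (interiorFF_intro ?_ fun C _ =>
      .impI (nn_bind hyp (nn_intro (of_singleton (intro_int B hvB hB)
        (elim (.wk (.wk (.assumption rfl))) (of_singleton hA' hyp)))))), ?_⟩
    · intro C hC
      rw [Set.mem_singleton_iff.1 hC]
      exact hfv _ hv'
    · obtain ⟨E, hE, -, hel⟩ := hΓ B (.inr (.inr B.mem_subformulas_self))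
      refine .impI (hel _ _ ?_ (hfv _ hvB) ?_)
      · simp only [Set.mem_insert_iff, Set.mem_singleton_iff, forall_eq_or_imp, forall_eq]
        exact ⟨hfv _ hvA, hint _⟩
      · refine elim hyp.wk (nn_elim (int_elim (A.imp B).boxRS hE (by simp)) ?_)
        have h1 := fun Θ => interiorFF_elim (Ax := Ax) hE (hyp :
          IQC.Derives Ax (insert ((Formula.imp A.boxRS.box B.boxRS.box).interiorFF f ys Γ) Θ) _)
        refine nn_elim (elim (h1 _) (nn_intro (of_singleton (intro_int A hvA hA)
          hyp.wk.wk.wk))) ?_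
        exact elim hyp.wk.wk (of_singleton hB' hyp)
  | ex x A ih =>
    have hv' := hv
    simp only [IQC.Formula.vars, Finset.mem_insert] at hv
    have hvA := fun n hn => hv n (.inr hn)
    have hx := hv x (.inl rfl)
    obtain ⟨hA, hA'⟩ := ih hvA fun C hC => hΓ C (.inr hC)
    have hxfv : x ∉ (IQC.Formula.ex x A).fv := by simp [IQC.Formula.fv]
    have e : ∀ E, (IQC.Formula.ex x A).boxRS.closedFF f ys Γ E =
        nn E (.ex x (nn E (A.boxRS.interiorFF f ys Γ))) := by
      intro E
      simp only [IQC.Formula.boxRS, Formula.closedFF, hx.1, Formula.interiorFF]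
    refine ⟨fun E => ?_, ?_⟩
    · rw [e]
      refine nn_intro (.exE (Δ := ∅) (.assumption rfl)
        (ex_self (nn_intro (of_singleton (intro_int A hvA hA) hyp))) (Set.empty_subset _)
        (fun C hC => absurd hC (Set.notMem_empty C)) (by simp [IQC.Formula.fv]))
    · obtain ⟨E, hE, hEfv, hel⟩ := hΓ _ (IQC.Formula.mem_subformulas_self _)
      -- The eigenvariable condition for eliminating ∃ towards `E`. It holds even when `Γ` consists
      -- of the subformulas themselves, since `E` has no free variables beyond those of `∃ x A` and
      -- `ys`.
      have hxE : x ∉ E.fv := fun h => (hEfv x h).elim hxfv hx.2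
      refine hel _ _ (by simpa using hint _) (hfv _ hv') ?_
      have := int_elim (IQC.Formula.ex x A).boxRS hE (Θ := {IQC.Formula.imp (.ex x A) E,
        .imp E (.ex x A), (IQC.Formula.ex x A).boxRS.interiorFF f ys Γ}) (by simp)
      rw [e] at this
      refine elim hyp.wk (nn_elim this
        (.exE (Δ := {IQC.Formula.imp (.ex x A) E}) hyp ?_ ?_ ?_ hxE))
      · exact nn_elim hyp (elim (.wk (.wk (.assumption rfl))) (ex_self (of_singleton hA' hyp)))
      · simp
      · intro C hC
        rw [Set.mem_singleton_iff.1 hC, IQC.Formula.fv, Finset.mem_union]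
        exact fun h => h.elim hxfv hxE
  | all x A ih =>
    have hv' := hv
    simp only [IQC.Formula.vars, Finset.mem_insert] at hv
    have hvA := fun n hn => hv n (.inr hn)
    have hx := hv x (.inl rfl)
    obtain ⟨hA, hA'⟩ := ih hvA fun C hC => hΓ C (.inr hC)
    have e : ∀ E, (IQC.Formula.all x A).boxRS.closedFF f ys Γ E =
        .all x (A.boxRS.closedFF f ys Γ E) := by
      intro E
      simp only [IQC.Formula.boxRS, Formula.closedFF, hx.1]
    have hall : ∀ {B C : IQC.Formula L}, IQC.Derives Ax {.all x B} C →
        IQC.Derives Ax {.all x B} (.all x C) := fun h =>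
      .allI (fun C hC => by rw [Set.mem_singleton_iff.1 hC]; simp [IQC.Formula.fv]) h
    refine ⟨fun E => ?_, ?_⟩
    · rw [e]
      exact hall (of_singleton (hA E) (all_self (.assumption rfl)))
    · refine .allI ?_ (of_singleton hA' (interiorFF_intro (by simpa using hint _) fun C hC =>
        all_self (x := x) (e C ▸ interiorFF_elim hC (.assumption rfl))))
      intro C hC
      rw [Set.mem_singleton_iff.1 hC, Formula.interiorFF, IQC.Formula.mem_fv_allList,
        IQC.Formula.mem_fv_bigAnd]
      rintro ⟨⟨B, hB, h⟩, -⟩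
      obtain ⟨E, -, rfl⟩ := List.mem_map.1 hB
      rw [e] at h
      simp [IQC.Formula.fv] at h

end EQC

/-! ### Fresh copies of formulas, and equations linking them to the originals -/

namespace IQC

variable {L : FirstOrder.Language.{u, v}}

namespace Formula

/-- Replace each free variable `x` in the list by the variable `y x`. -/
def substList (y : ℕ → ℕ) : List ℕ → Formula L → Formula L
  | [], A => A
  | x :: l, A => (substList y l A).subst x (.var (y x))

theorem mem_fv_substList {y : ℕ → ℕ} {l : List ℕ} {A : Formula L} {n : ℕ}
    (h : n ∈ (substList y l A).fv) : n ∈ l.map y ∨ (n ∈ A.fv ∧ n ∉ l) := by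
  induction l with
  | nil => exact .inr ⟨h, List.not_mem_nil⟩
  | cons x l ih =>
    rw [List.map_cons, List.mem_cons, List.mem_cons]
    rcases mem_fv_subst h with h | h
    · exact .inl (.inl (mem_varFinset_var.1 h))
    · have := ih h.1
      tauto

theorem bv_substList (y : ℕ → ℕ) (l : List ℕ) (A : Formula L) : (substList y l A).bv = A.bv := by
  induction l with
  | nil => rfl
  | cons x l ih => rw [substList, bv_subst, ih]

/-- The equations `y x = x` for `x` in the list. -/
def eqnSet (L : FirstOrder.Language.{u, v}) (y : ℕ → ℕ) (l : List ℕ) : Set (Formula L) :=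
  {C | ∃ x ∈ l, C = eq (.var (y x)) (.var x)}

theorem eqnSet_cons (y : ℕ → ℕ) (x : ℕ) (l : List ℕ) :
    eqnSet L y (x :: l) = insert (eq (.var (y x)) (.var x)) (eqnSet L y l) := by
  ext C
  simp [eqnSet]

end Formula

namespace Derives

open Formula

variable {Ax : Set (Formula L)}

theorem eq_symm {Γ : Set (Formula L)} {x y : ℕ} (hxy : y ≠ x)
    (h : Derives Ax Γ (.eq (.var y) (.var x))) : Derives Ax Γ (.eq (.var x) (.var y)) := by
  have e : ∀ t : L.Term ℕ, (Formula.eq (.var x) (.var y)).subst x t = .eq t (.var y) := by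
    intro t
    simp only [subst, termSubst_var, if_true, if_neg hxy]
  have := eqSub (x := x) (A := .eq (.var x) (.var y)) (.var y) (.var x) trivial trivial h
    (by rw [e]; exact eqI _)
  rwa [e] at this

/-- Replacement of equals, one variable at a time and in both directions; the fresh variables are
not bound in `A`, so they are free for the variables they replace. -/
theorem substList_iff {y : ℕ → ℕ} {l : List ℕ} {A : Formula L} (hy : ∀ x, y x ∉ A.bv)
    (hl : ∀ x ∈ l, y x ≠ x) :
    Derives Ax (eqnSet L y l) (.imp A (substList y l A)) ∧
      Derives Ax (eqnSet L y l) (.imp (substList y l A) A) := by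
  induction l with
  | nil => exact ⟨impI hyp, impI hyp⟩
  | cons x l ih =>
    rw [List.forall_mem_cons] at hl
    obtain ⟨h1, h2⟩ := ih hl.2
    rw [eqnSet_cons, substList]
    set G := substList y l A
    have hG : G.FreeFor x (.var (y x)) := freeFor_of_disjoint fun z hz hz' => by
      rw [mem_varFinset_var.1 hz', bv_substList] at hz
      exact hy x hz
    constructor
    · refine impI (eqSub (.var x) (.var (y x)) (freeFor_self x G) hG (eq_symm hl.1 hyp.wk) ?_)
      rw [subst_self]
      exact impE hyp h1.wk.wk
    · refine impI (impE ?_ h2.wk.wk)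
      have := eqSub (.var (y x)) (.var x) hG (freeFor_self x G) hyp.wk hyp (Ax := Ax)
        (Γ := insert (G.subst x (.var (y x))) (insert (eq (.var (y x)) (.var x)) (eqnSet L y l)))
      rwa [subst_self] at this

/-- Each equation is discharged by ∃-elimination from the provable `∃ y, y = x`. Injectivity and the
absence of repetitions keep the eigenvariable out of the remaining equations. -/
theorem of_eqnSet {y : ℕ → ℕ} {l : List ℕ} {Δ : Set (Formula L)} {D : Formula L}
    (hinj : y.Injective) (hne : ∀ x, ∀ z ∈ l, y x ≠ z) (hl : l.Nodup)
    (hΔ : ∀ C ∈ Δ, ∀ x ∈ l, y x ∉ C.fv) (hD : ∀ x ∈ l, y x ∉ D.fv)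
    (h : Derives Ax (eqnSet L y l ∪ Δ) D) : Derives Ax Δ D := by
  induction l with
  | nil => simpa [eqnSet] using h
  | cons x l ih =>
    rw [List.nodup_cons] at hl
    rw [eqnSet_cons, Set.insert_union] at h
    refine ih (fun x z hz => hne x z (.tail _ hz)) hl.2
      (fun C hC z hz => hΔ C hC z (.tail _ hz)) (fun z hz => hD z (.tail _ hz)) ?_
    have hx : x ≠ y x := (hne x x (.head _)).symm
    refine exE (Δ := eqnSet L y l ∪ Δ) (x := y x) (A := eq (.var (y x)) (.var x)) ?_ h
      (Set.Subset.refl _) ?_ (hD x (.head _))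
    · refine exI (.var x) trivial ?_
      simp only [subst, termSubst_var, if_true, if_neg hx]
      exact eqI _
    · rintro C (⟨z, hz, rfl⟩ | hC)
      · simp only [fv, Finset.mem_union, mem_varFinset_var, not_or]
        exact ⟨fun e => hl.1 (hinj e ▸ hz), hne x z (.tail _ hz)⟩
      · exact hΔ C hC x (.head _)

end Derives

end IQC

/-! ### Construction of the parameters, and faithfulness of the translation -/

namespace EQC

variable {L : FirstOrder.Language.{u, v}}

theorem exists_paramSystem (A : IQC.Formula L) :
    ∃ (f : ℕ → ℕ) (ys : List ℕ) (Γ : List (IQC.Formula L)), ParamSystem f ys Γ ∧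
      (∀ n ∈ A.vars, f n = n ∧ n ∉ ys) ∧
      ∀ Ax, ∀ B ∈ A.subformulas, Represents Ax ys Γ B := by
  obtain ⟨N, hN⟩ : ∃ N, ∀ n ∈ A.vars, n < N :=
    ⟨A.vars.sup id + 1, fun n hn => Nat.lt_succ_of_le (Finset.le_sup (f := id) hn)⟩
  have hsub : ∀ B ∈ A.subformulas, ∀ n ∈ B.vars, n < N :=
    fun B hB n hn => hN n (IQC.Formula.vars_subset_of_mem_subformulas hB hn)
  -- The parameters are odd and exceed `N`. The renaming below fixes the variables less than `N`,
  -- which include all those of the given formula, and sends the others to even numbers, so its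
  -- range misses the parameters.
  let y : ℕ → ℕ := fun i => 2 * (N + i) + 1
  have hyinj : y.Injective := fun a b h => by simp only [y] at h; omega
  have hyN : ∀ i, N < y i := fun i => by simp only [y]; omega
  have hfv : ∀ B ∈ A.subformulas, ∀ n ∈ (IQC.Formula.substList y (List.range N) B).fv,
      n ∈ (List.range N).map y := by
    intro B hB n hn
    rcases IQC.Formula.mem_fv_substList hn with h | h
    · exact h
    · exact absurd (List.mem_range.2 (hsub B hB n (B.fv_subset_vars h.1))) h.2
  refine ⟨fun n => if n < N then n else 2 * n, (List.range N).map y,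
    A.finite_subformulas.toFinset.toList.map (IQC.Formula.substList y (List.range N)),
    ⟨?_, ?_, ?_⟩, ?_, ?_⟩
  · intro a b h
    simp only at h
    split_ifs at h <;> omega
  · intro n hn
    obtain ⟨i, -, hi⟩ := List.mem_map.1 hn
    simp only [y] at hi
    split_ifs at hi <;> omega
  · intro C hC
    obtain ⟨B, hB, rfl⟩ := List.mem_map.1 hC
    rw [Finset.mem_toList, Set.Finite.mem_toFinset] at hB
    exact hfv B hB
  · intro n hn
    refine ⟨if_pos (hN n hn), fun h => ?_⟩
    obtain ⟨i, -, rfl⟩ := List.mem_map.1 h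
    exact absurd (hN _ hn) (hyN i).not_gt
  · intro Ax B hB
    refine ⟨_, List.mem_map.2 ⟨B, by rwa [Finset.mem_toList, Set.Finite.mem_toFinset], rfl⟩,
      fun n hn => .inr (hfv B hB n hn), fun Δ D hΔ hD h => ?_⟩
    have hne : ∀ x, ∀ z ∈ List.range N, y x ≠ z := fun x z hz e =>
      (hyN x).not_gt (e ▸ List.mem_range.1 hz)
    obtain ⟨h1, h2⟩ := IQC.Derives.substList_iff (Ax := Ax) (y := y) (l := List.range N) (A := B)
      (fun x hx => (hyN x).not_gt (hsub B hB _ (B.bv_subset_vars hx))) fun x hx => hne x x hx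
    refine IQC.Derives.of_eqnSet (y := y) (l := List.range N) hyinj hne List.nodup_range
      (fun C hC x hx => hΔ C hC _ (List.mem_map_of_mem hx))
      (fun x hx => hD _ (List.mem_map_of_mem hx)) ?_
    refine IQC.Derives.cut (h2.weaken Set.subset_union_left) (IQC.Derives.cut
      (h1.weaken (Set.subset_union_left.trans (Set.subset_insert _ _))) (h.weaken ?_))
    exact Set.insert_subset_insert (Set.insert_subset_insert Set.subset_union_right)

/-- The Rasiowa–Sikorski translation reflects provability. -/
theorem derives_of_derives_boxRS {Ax : Set (IQC.Formula L)} {Ax' : Set (Formula L)}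
    (hAx : ∀ f ys (Γ : List (IQC.Formula L)), ParamSystem f ys Γ →
      ∀ M ∈ Ax', ∀ E ∈ Γ, IQC.Derives Ax ∅ (M.closedFF f ys Γ E))
    {A : IQC.Formula L} (h : Derives Ax' ∅ A.boxRS) : IQC.Derives Ax ∅ A := by
  obtain ⟨f, ys, Γ, hP, hv, hR⟩ := exists_paramSystem A
  refine (derives_closedFF_boxRS A hv (hR Ax)).2.of_singleton (interiorFF_intro ?_ fun E hE => ?_)
  · exact fun C hC => absurd hC (Set.notMem_empty C)
  · simpa using hP.soundness (hAx f ys Γ hP) h E hE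

end EQC

/-! ### Soundness of the Rasiowa–Sikorski translation -/

namespace EQC

variable {L : FirstOrder.Language.{u, v}}

theorem _root_.IQC.Formula.fv_boxRS (A : IQC.Formula L) : A.boxRS.fv = A.fv := by
  induction A with
  | falsum | eq s t | rel R ts => rfl
  | and A B ihA ihB | or A B ihA ihB | imp A B ihA ihB =>
    simp only [IQC.Formula.boxRS, Formula.fv, IQC.Formula.fv, ihA, ihB]
  | ex x A ih | all x A ih => simp only [IQC.Formula.boxRS, Formula.fv, IQC.Formula.fv, ih]

theorem _root_.IQC.Formula.boxRS_subst (x : ℕ) (t : L.Term ℕ) (A : IQC.Formula L) :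
    (A.subst x t).boxRS = A.boxRS.subst x t := by
  induction A with
  | falsum | eq s t | rel R ts => rfl
  | and A B ihA ihB | or A B ihA ihB | imp A B ihA ihB =>
    simp only [IQC.Formula.boxRS, Formula.subst, IQC.Formula.subst, ihA, ihB]
  | ex y A ih | all y A ih =>
    simp only [IQC.Formula.boxRS, Formula.subst, IQC.Formula.subst]
    split_ifs <;> simp only [IQC.Formula.boxRS, ih]

theorem _root_.IQC.Formula.freeFor_boxRS {x : ℕ} {t : L.Term ℕ} {A : IQC.Formula L} :
    A.boxRS.FreeFor x t ↔ A.FreeFor x t := by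
  induction A with
  | falsum | eq s t | rel R ts => rfl
  | and A B ihA ihB | or A B ihA ihB | imp A B ihA ihB =>
    simp only [IQC.Formula.boxRS, Formula.FreeFor, IQC.Formula.FreeFor, ihA, ihB]
  | ex y A ih | all y A ih =>
    simp only [IQC.Formula.boxRS, Formula.FreeFor, IQC.Formula.FreeFor, ih, Formula.fv,
      IQC.Formula.fv, IQC.Formula.fv_boxRS]

theorem Formula.subst_self (x : ℕ) (A : Formula L) : A.subst x (.var x) = A := by
  induction A with
  | falsum => rfl
  | eq r s => simp only [subst, termSubst_self]
  | rel R ts => simp only [subst, termSubst_self]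
  | and A B ihA ihB | or A B ihA ihB | imp A B ihA ihB => simp only [subst, ihA, ihB]
  | ex y A ih | all y A ih => simp only [subst, ih, ite_self]
  | box A ih => simp only [subst, ih]

theorem Formula.freeFor_self (x : ℕ) (A : Formula L) : A.FreeFor x (.var x) := by
  induction A with
  | falsum | eq r s | rel R ts => trivial
  | and A B ihA ihB | or A B ihA ihB | imp A B ihA ihB => exact ⟨ihA, ihB⟩
  | ex y A ih | all y A ih =>
    by_cases h : y = x
    · exact .inl (by simp [fv, h])
    · exact .inr ⟨by rwa [mem_varFinset_var], ih⟩
  | box A ih => exact ih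

namespace Derives

variable {Ax : Set (Formula L)} {Γ : Set (Formula L)} {A B : Formula L}

theorem wk (h : Derives Ax Γ A) : Derives Ax (insert B Γ) A := h.weaken (Set.subset_insert _ _)

theorem hyp : Derives Ax (insert A Γ) A := assumption (Set.mem_insert _ _)

theorem falsumE (h : Derives Ax Γ .falsum) : Derives Ax Γ A := raa h.wk

theorem all_self {x : ℕ} (h : Derives Ax Γ (.all x A)) : Derives Ax Γ A := by
  have := allE (.var x) (Formula.freeFor_self x A) h
  rwa [Formula.subst_self] at this

end Derives

open Derives in
-- Boxing the translated assumptions makes □-introduction available at every step, so the boxes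
-- demanded by ∨, ⊃ and ∃ can be added. Equations carry no box, so the substitution rule for
-- equality applies directly.
theorem derives_boxRS_of_derives {Ax : Set (IQC.Formula L)} {Ax' : Set (Formula L)}
    (hAx : ∀ A ∈ Ax, Derives Ax' ∅ A.boxRS) {Γ : Set (IQC.Formula L)} {A : IQC.Formula L}
    (h : IQC.Derives Ax Γ A) :
    Derives Ax' ((fun B => Formula.box B.boxRS) '' Γ) A.boxRS := by
  have box : ∀ {Γ : Set (IQC.Formula L)} {M : Formula L},
      Derives Ax' ((fun B => Formula.box B.boxRS) '' Γ) M →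
      Derives Ax' ((fun B => Formula.box B.boxRS) '' Γ) (.box M) := by
    refine fun h => boxI ?_ h
    rintro _ ⟨B, -, rfl⟩
    exact ⟨_, rfl⟩
  have ctx : ∀ {Γ : Set (IQC.Formula L)} {x : ℕ}, (∀ C ∈ Γ, x ∉ C.fv) →
      ∀ C ∈ (fun B : IQC.Formula L => Formula.box B.boxRS) '' Γ, x ∉ C.fv := by
    rintro Γ x h _ ⟨B, hB, rfl⟩
    rw [Formula.fv, IQC.Formula.fv_boxRS]
    exact h B hB
  induction h with
  | ax h => exact (hAx _ h).weaken (Set.empty_subset _)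
  | assumption h => exact .boxE (.assumption (Set.mem_image_of_mem _ h))
  | weaken hs _ ih => exact ih.weaken (Set.image_mono hs)
  | andI _ _ ih₁ ih₂ => exact .andI ih₁ ih₂
  | andE₁ _ ih => exact .andE₁ ih
  | andE₂ _ ih => exact .andE₂ ih
  | orI₁ _ ih => exact .orI₁ (box ih)
  | orI₂ _ ih => exact .orI₂ (box ih)
  | orE _ _ _ ih ihA ihB =>
    rw [Set.image_insert_eq] at ihA ihB
    exact .orE ih ihA ihB
  | impI _ ih =>
    have := box ih
    rw [Set.image_insert_eq] at this
    exact box (.impI this)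
  | impE _ _ ih₁ ih₂ => exact .boxE (.impE (box ih₁) (.boxE ih₂))
  | falsumE _ ih => exact ih.falsumE
  | @exI Γ x A t hf _ ih =>
    refine .exI t (IQC.Formula.freeFor_boxRS.2 hf) (A := A.boxRS.box) ?_
    rw [IQC.Formula.boxRS_subst] at ih
    have := box (M := A.boxRS.subst x t) ih
    exact this
  | exE _ _ hs hx hB ih₁ ih₂ =>
    rw [Set.image_insert_eq] at ih₂
    exact .exE ih₁ ih₂ (Set.image_mono hs) (ctx hx) (by rwa [IQC.Formula.fv_boxRS])
  | allI hx _ ih => exact .allI (ctx hx) ih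
  | allE t hf _ ih =>
    rw [IQC.Formula.boxRS_subst]
    exact .allE t (IQC.Formula.freeFor_boxRS.2 hf) ih
  | eqI t => exact .eqI t
  | eqSub s t hs ht _ _ ih₁ ih₂ =>
    rw [IQC.Formula.boxRS_subst] at ih₂ ⊢
    exact .eqSub s t (IQC.Formula.freeFor_boxRS.2 hs) (IQC.Formula.freeFor_boxRS.2 ht) ih₁ ih₂

end EQC

/-! ### Arithmetic -/

namespace arith

variable (f : ℕ → ℕ)

theorem relabel_zero : zero.relabel f = zero := by
  simp only [zero, FirstOrder.Language.Term.relabel]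
  congr 1
  exact funext fun i => i.elim0

theorem relabel_succ (t : arith.Term ℕ) : (succ t).relabel f = succ (t.relabel f) := by
  simp only [succ, FirstOrder.Language.Term.relabel]
  congr 1
  exact funext fun i => by fin_cases i; rfl

theorem relabel_add (s t : arith.Term ℕ) :
    (add s t).relabel f = add (s.relabel f) (t.relabel f) := by
  simp only [add, FirstOrder.Language.Term.relabel]
  congr 1
  exact funext fun i => by fin_cases i <;> rfl

theorem relabel_mul (s t : arith.Term ℕ) :
    (mul s t).relabel f = mul (s.relabel f) (t.relabel f) := by
  simp only [mul, FirstOrder.Language.Term.relabel]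
  congr 1
  exact funext fun i => by fin_cases i <;> rfl

end arith

open IQC.Derives in
-- An induction axiom becomes the induction axiom for the translated formula, because translation
-- commutes with substitution, ∧, ⊃ and ∀. The other axioms need only double negations.
theorem EAAxiom.derives_closedFF {f : ℕ → ℕ} {ys : List ℕ} {Γ : List (IQC.Formula arith)}
    (hP : EQC.ParamSystem f ys Γ) {M : EQC.Formula arith} (h : EAAxiom M)
    {E : IQC.Formula arith} (hE : E ∈ Γ) :
    IQC.Derives {B | HAAxiom B} ∅ (M.closedFF f ys Γ E) := by
  cases h with
  | succ_ne_zero t =>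
    simp only [EQC.Formula.neg, EQC.Formula.closedFF, arith.relabel_succ, arith.relabel_zero]
    exact .impI (nn_bind hyp (nn_intro (.impE hyp (.ax (.succ_ne_zero _)))))
  | succ_inj s t =>
    simp only [EQC.Formula.closedFF, arith.relabel_succ]
    exact .impI (nn_bind hyp (nn_intro (.impE hyp (.ax (.succ_inj _ _)))))
  | add_zero t =>
    simp only [EQC.Formula.closedFF, arith.relabel_add, arith.relabel_zero]
    exact nn_intro (.ax (.add_zero _))
  | add_succ s t =>
    simp only [EQC.Formula.closedFF, arith.relabel_add, arith.relabel_succ]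
    exact nn_intro (.ax (.add_succ _ _))
  | mul_zero t =>
    simp only [EQC.Formula.closedFF, arith.relabel_mul, arith.relabel_zero]
    exact nn_intro (.ax (.mul_zero _))
  | mul_succ s t =>
    simp only [EQC.Formula.closedFF, arith.relabel_add, arith.relabel_mul, arith.relabel_succ]
    exact nn_intro (.ax (.mul_succ _ _))
  | induction x A =>
    simp only [EQC.Formula.closedFF, hP.closedFF_subst _ _ _ hE, arith.relabel_zero,
      arith.relabel_succ, FirstOrder.Language.Term.relabel]
    exact .ax (.induction _ _)

open EQC.Derives in
theorem HAAxiom.derives_boxRS {A : IQC.Formula arith} (h : HAAxiom A) :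
    EQC.Derives {B | EAAxiom B} ∅ A.boxRS := by
  have imp : ∀ {M N : EQC.Formula arith}, EQC.Derives {B | EAAxiom B} {M.box} N →
      EQC.Derives {B | EAAxiom B} ∅ (.box (.imp M.box N.box)) := by
    refine fun h => .boxI (fun C hC => absurd hC (Set.notMem_empty C)) (.impI ?_)
    rw [insert_empty_eq]
    exact .boxI (fun C hC => ⟨_, hC⟩) h
  cases h with
  | succ_ne_zero t =>
    exact imp (.impE (.boxE (.assumption rfl)) (.ax (.succ_ne_zero t)))
  | succ_inj s t => exact imp (.impE (.boxE (.assumption rfl)) (.ax (.succ_inj s t)))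
  | add_zero t => exact .ax (.add_zero t)
  | add_succ s t => exact .ax (.add_succ s t)
  | mul_zero t => exact .ax (.mul_zero t)
  | mul_succ s t => exact .ax (.mul_succ s t)
  | induction x A =>
    refine imp ?_
    simp only [IQC.Formula.boxRS, IQC.Formula.boxRS_subst]
    set S := arith.succ (FirstOrder.Language.Term.var x)
    set P : EQC.Formula arith := .and (A.boxRS.subst x arith.zero)
      (.all x (.box (.imp A.boxRS.box (A.boxRS.subst x S).box)))
    have hP : EQC.Derives {B | EAAxiom B} {P.box} P := .boxE (.assumption rfl)
    -- Induction is applied to the boxed formula `A.boxRS.box`, since the translated induction step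
    -- leads from a box to a box; the boxes are removed afterwards.
    have hind : EQC.Derives {B | EAAxiom B} {P.box} (.all x A.boxRS.box) := by
      refine .impE ?_ (.ax (.induction x A.boxRS.box))
      refine .andI (.boxI (fun C hC => ⟨_, hC⟩) hP.andE₁) ?_
      have h : EQC.Derives {B | EAAxiom B}
          {.all x (.box (.imp A.boxRS.box (A.boxRS.subst x S).box))}
          (.all x (.imp A.boxRS.box (A.boxRS.subst x S).box)) :=
        .allI (fun C hC => by rw [Set.mem_singleton_iff.1 hC]; simp [EQC.Formula.fv])
          (.boxE (all_self (.assumption rfl)))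
      exact .impE hP.andE₂ (.impI (h.weaken (by simp)))
    have h : EQC.Derives {B | EAAxiom B} {.all x A.boxRS.box} (.all x A.boxRS) :=
      .allI (fun C hC => by rw [Set.mem_singleton_iff.1 hC]; simp [EQC.Formula.fv])
        (.boxE (all_self (.assumption rfl)))
    exact .impE hind (.impI (h.weaken (by simp)))

/-! ### The main theorem -/

theorem theorem2p3 :
    (∀ (L : FirstOrder.Language.{u, v}) (A : IQC.Formula L), IQC.Provable A ↔ EQC.Provable A.boxRS) ∧
    (∀ A : IQC.Formula arith, HA.Provable A ↔ EA.Provable A.boxRS) ∧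
    (∀ (L : FirstOrder.Language.{u, v}) (A : IQC.Formula L) (Γ : List (IQC.Formula L)),
      (∀ C, C ∈ Γ ↔ C ∈ A.subformulas) →
      IQC.Interderivable A
        (IQC.Formula.bigAnd (Γ.map fun C => A.boxRS.flaggFriedman Γ C))) := by
  refine ⟨fun L A => ⟨fun h => ?_, fun h => ?_⟩, fun A => ⟨fun h => ?_, fun h => ?_⟩,
    fun L A Γ hΓ => ?_⟩
  · simpa [EQC.Provable] using EQC.derives_boxRS_of_derives (Ax' := ∅)
      (fun A hA => absurd hA (Set.notMem_empty A)) h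
  · exact EQC.derives_of_derives_boxRS (fun _ _ _ _ M hM => absurd hM (Set.notMem_empty M)) h
  · simpa [EA.Provable] using EQC.derives_boxRS_of_derives (fun A hA => HAAxiom.derives_boxRS hA) h
  · exact EQC.derives_of_derives_boxRS
      (fun _ _ _ hP M hM E hE => EAAxiom.derives_closedFF hP hM hE) h
  · obtain ⟨h1, h2⟩ := EQC.derives_closedFF_boxRS (Ax := ∅) (f := id) (ys := []) (Γ := Γ) A
      (fun n _ => ⟨rfl, List.not_mem_nil⟩) fun B hB => ⟨B, (hΓ B).2 hB, fun n hn => .inl hn,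
        fun Δ D _ _ h => .cut (.impI .hyp) (.cut (.impI .hyp) h)⟩
    rw [EQC.Formula.interiorFF_id_nil] at h2
    refine ⟨.bigAnd_intro fun B hB => ?_, h2⟩
    obtain ⟨E, -, rfl⟩ := List.mem_map.1 hB
    exact EQC.Formula.closedFF_id_nil A.boxRS E ▸ h1 E
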